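/- **Notation.** For a finite set $X$, $\mathfrak P(X)$ is the set of partitions of $X$ (into non-empty parts) and $\mathfrak P^f(X)=\mathfrak P(X)\setminus\{\{X\}\}$ the set of partitions finer than $\{X\}$. A *hierarchy* on $X\neq\emptyset$ is a rooted tree of subsets of $X$ with root $X$, in which the children of each node $A$ with $|A|\ge 2$ are the parts of some $\mathcal B\in\mathfrak P^f(A)$, and whose leaves are the singletons; $\mathfrak H(X)$ is the (finite) set of hierarchies. **(I) Finite index set.** Let $\Lambda$ be a finite set, let $W:\mathbb R^\Lambda\to\mathbb R$ be strictly convex and real analytic, put $\langle\varphi,J\rangle=\sum_x\varphi_xJ^x$, let $$\Gamma[\varphi]=\inf_{J}\{W[J]-\langle\varphi,J\rangle\}$$ be its Legendre transform and $\bar\phi_x[J]=\delta W/\delta J^x$ the mean field. Let $J$ be a source at which the matrix $W''[J]=\big(\delta^2W/\delta J^x\delta J^y\big)$ is positive definite. Then the infimum defining $\Gamma[\bar\phi[J]]$ is attained exactly at $J$, $\Gamma$ is real analytic near $\bar\phi[J]$, and, with $$\bar\Gamma^{Z}[J]=\frac{\delta^{|Z|}\Gamma}{\delta\varphi_Z}\Big|_{\varphi=\bar\phi[J]},$$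 for every finite family $X=\{x_i\}$ of (not necessarily distinct) labels $x_i\in\Lambda$ and every $y\in\Lambda$ the following hold at $J$. (a) If $|X|\ge 2$, $$\frac{\delta^{|X|+1}W}{\delta J^{X\cup\{y\}}}=\sum_{\mathcal A\in\mathfrak P^f(X)}\frac{\delta^2W}{\delta J^y\delta J^p}\;\bar\Gamma^{\{p\}\cup Z_{\mathcal A}}\;\prod_{A\in\mathcal A}\frac{\delta^{|A|+1}W}{\delta J^{A\cup\{z_A\}}},$$ where $Z_{\mathcal A}=\{z_A:A\in\mathcal A\}$ has one dummy label for each part, and $p$ and all $z_A$ are summed over $\Lambda$. (b) If $|X|\ge 1$, $$\frac{\delta^{|X|+1}W}{\delta J^{X\cup\{y\}}}=\sum_{\mathcal H\in\mathfrak H(X)}\mathcal T_{\mathcal H}(y),$$ where the amplitude $\mathcal T_{\mathcal H}(y)$ of a hierarchy is given recursively by $\mathcal T_{\mathcal H}(y)=\dfrac{\delta^2W}{\delta J^y\delta J^{x_i}}$ if $\mathcal H$ is the single leaf $\{x_i\}$, and by $$\mathcal T_{\mathcal H}(y)=\sum_{p,\,z}\frac{\delta^2W}{\delta J^y\delta J^p}\;\bar\Gamma^{\{p\}\cup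 Z_{\mathcal A}}\prod_{A\in\mathcal A}\mathcal T_{\mathcal H_A}(z_A)$$ if the root of $\mathcal H$ has the set of children $\mathcal A\in\mathfrak P^f(X)$, with sub-hierarchies $\mathcal H_A\in\mathfrak H(A)$. **(II) Connected cumulants.** Let $\nu$ be a probability measure on $\mathbb R^\Lambda$, $\Lambda$ finite, with $Z[J]=\int e^{\langle\varphi,J\rangle}d\nu(\varphi)<\infty$ for all $J$, let $d\nu^J=Z[J]^{-1}e^{\langle\varphi,J\rangle}d\nu$, and suppose that $W=\ln Z$ is strictly convex and analytic. Define the connected cumulants $\langle\!\langle\phi_X\rangle\!\rangle_{\nu^J}$ by $\int\prod_{x\in X}\varphi_x\,d\nu^J=\sum_{\mathcal A\in\mathfrak P(X)}\prod_{A\in\mathcal A}\langle\!\langle\phi_A\rangle\!\rangle_{\nu^J}$ for $X\ne\emptyset$. If $W''[J]$ is positive definite, then $\bar\phi_x[J]=\int\varphi_x\,d\nu^J$, and (a) and (b) hold with every derivative $\delta^{|Y|}W/\delta J^{Y}$ occurring in them replaced by $\langle\!\langle\phi_Y\rangle\!\rangle_{\nu^J}$. **(III) Infinitely many degrees of freedom.**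 Let $E$ be a real Banach space of sources, with dual $E'$ as space of fields, let $W:E\to\mathbb R$ be strictly convex and real analytic, $\Gamma[\varphi]=\inf_{J\in E}\{W[J]-\varphi(J)\}$ for $\varphi\in E'$, and $\bar\phi[J]=DW[J]\in E'$. Let $J\in E$ be such that $W''[J]$ is coercive: $D^2W[J](h,h)\ge c\|h\|^2$ for all $h\in E$ and some $c>0$. Then the infimum defining $\Gamma[\bar\phi[J]]$ is attained exactly at $J$, $\Gamma$ is real analytic near $\bar\phi[J]$, and for all finite families $h_X=(h_i)_{i\in X}$ in $E$ and all $k\in E$: if $|X|\ge2$, $$D^{|X|+1}W[J](k,h_X)=\sum_{\mathcal A\in\mathfrak P^f(X)}D^{|\mathcal A|+1}\Gamma\big[\bar\phi[J]\big]\Big(D^2W[J](k,\cdot),\;\big(D^{|A|+1}W[J](\cdot,h_A)\big)_{A\in\mathcal A}\Big),$$ and if $|X|\ge1$, $D^{|X|+1}W[J](k,h_X)=\sum_{\mathcal H\in\mathfrak H(X)}\mathcal T_{\mathcal H}(k)$, where $\mathcal T_{\mathcal H}=D^2W[J](h_i,\cdot)\in E'$ for a single leaf $\{i\}$, and otherwise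 $\mathcal T_{\mathcal H}(k)=D^{|\mathcal A|+1}\Gamma[\bar\phi[J]]\big(D^2W[J](k,\cdot),(\mathcal T_{\mathcal H_A})_{A\in\mathcal A}\big)$, with $\mathcal A$ and $\mathcal H_A$ as in (b). -/

import Mathlib

open MeasureTheory

universe u v

namespace FieldCalculus

noncomputable section

/-! ### Functional derivatives -/

section Derivatives

variable {E : Type*} [NormedAddCommGroup E] [NormedSpace ℝ E]

/-- The derivative of `F` at `u` of order `|κ|`, as a multilinear form whose arguments are labelled
by the finite type `κ`. (For the smooth `F` of interest the form is symmetric, so the enumeration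
of `κ` is irrelevant.) -/
def multiDeriv {κ : Type*} [Fintype κ] (F : E → ℝ) (u : E) :
    ContinuousMultilinearMap ℝ (fun _ : κ => E) ℝ :=
  (iteratedFDeriv ℝ (Fintype.card κ) F u).domDomCongr (Fintype.equivFin κ).symm

/-- The family on `κ ∪ {∗}` that is `v` on `κ` and `a` at the additional label. -/
def adjoin {α : Type*} {κ : Type*} (a : α) (v : κ → α) : Option κ → α :=
  fun o => o.elim a v

/-- The covector `k ↦ D^{|κ|+1} F[u](k, h)`: one slot of the derivative is left open. -/
def openDeriv {κ : Type*} [Fintype κ] (F : E → ℝ) (u : E) (h : κ → E) : StrongDual ℝ E := by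
  classical
  exact (multiDeriv (κ := Option κ) F u).toContinuousLinearMap (adjoin 0 h) none

/-- The second derivative `F''[u] : E → E'`. -/
def hessian (F : E → ℝ) (u : E) : E →L[ℝ] StrongDual ℝ E := fderiv ℝ (fderiv ℝ F) u

/-- A strictly convex, real analytic functional. -/
structure IsStrictlyConvexAnalytic (W : E → ℝ) : Prop where
  analytic : AnalyticOnNhd ℝ W Set.univ
  strictConvex : StrictConvexOn ℝ Set.univ W

end Derivatives

/-- The Legendre–Fenchel transform `Γ[φ] = inf_J (W[J] - ⟨φ, J⟩)` for a pairing `⟨·,·⟩`. -/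
def legendre {S F : Type*} (pairing : F → S → ℝ) (W : S → ℝ) (φ : F) : ℝ :=
  ⨅ J : S, (W J - pairing φ J)

/-! ### Partitions and hierarchies -/

section Hierarchies

/-- The partitions of `X` finer than `{X}`, i.e. all partitions of `X` but the coarsest one. -/
abbrev FinerPartition {ι : Type u} [DecidableEq ι] (X : Finset ι) : Type u :=
  {P : Finpartition X // P ≠ ⊤}

instance {ι : Type u} [DecidableEq ι] (X : Finset ι) : Fintype (FinerPartition X) :=
  Fintype.ofFinite _

theorem FinerPartition.card_lt {ι : Type u} [DecidableEq ι] {X : Finset ι} (P : FinerPartition X)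
    {A : Finset ι} (hA : A ∈ P.1.parts) : A.card < X.card := by
  refine Finset.card_lt_card (lt_of_le_of_ne (P.1.le hA) ?_)
  rintro rfl
  exact P.2 (top_le_iff.1 fun B hB => ⟨A, hA, (⊤ : Finpartition A).le hB⟩)

/-- Hierarchies on a finite set: rooted trees of subsets with root `X`, in which the children of a
node `A` that is not a singleton are the parts of a partition of `A` finer than `{A}`, and whose
leaves are the singletons. -/
inductive Hierarchy {ι : Type u} [DecidableEq ι] : Finset ι → Type u
  | leaf (i : ι) : Hierarchy {i}
  | node {X : Finset ι} (P : FinerPartition X) (sub : ∀ A : P.1.parts, Hierarchy A.1) :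
      Hierarchy X

theorem Hierarchy.finite_aux {ι : Type u} [DecidableEq ι] (n : ℕ) :
    ∀ X : Finset ι, X.card ≤ n → Finite (Hierarchy X) := by
  induction n with
  | zero =>
    intro X hX
    have : X = ∅ := by simpa using hX
    subst this
    refine @Finite.of_subsingleton _ ⟨fun H => ?_⟩
    exfalso
    generalize hY : (∅ : Finset ι) = Y at H
    cases H with
    | leaf i => exact absurd hY.symm (Finset.singleton_ne_empty i)
    | node P sub =>
      subst hY
      exact P.2 (top_le_iff.1 fun B hB =>
        absurd (le_bot_iff.1 ((⊤ : Finpartition (∅ : Finset ι)).le hB)) (Finpartition.ne_bot _ hB))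
  | succ n ih =>
    intro X hX
    have hfin : ∀ (P : FinerPartition X) (A : P.1.parts), Finite (Hierarchy A.1) := fun P A =>
      ih A.1 (by have := P.card_lt A.2; omega)
    let T := {i : ι // i ∈ X} ⊕ (Σ P : FinerPartition X, ∀ A : P.1.parts, Hierarchy A.1)
    let f : T → Option (Hierarchy X) := fun t => match t with
      | .inl i => if h : {i.1} = X then some (h ▸ Hierarchy.leaf i.1) else none
      | .inr ⟨P, s⟩ => some (.node P s)
    have hT : Finite T := inferInstance
    refine Finite.of_injective (β := Set.range f) (fun H => ⟨some H, ?_⟩) ?_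
    · cases H with
      | leaf i => exact ⟨.inl ⟨i, by simp⟩, by simp [f]⟩
      | node P s => exact ⟨.inr ⟨P, s⟩, rfl⟩
    · intro H K h
      simpa using h

instance {ι : Type u} [DecidableEq ι] (X : Finset ι) : Finite (Hierarchy X) :=
  Hierarchy.finite_aux X.card X le_rfl

instance {ι : Type u} [DecidableEq ι] (X : Finset ι) : Fintype (Hierarchy X) :=
  Fintype.ofFinite _

end Hierarchies

/-! ### Tensor components for a finite index set `Λ` -/

section Components

variable {Λ : Type v} [Fintype Λ] [DecidableEq Λ]

/-- The pairing `⟨φ, J⟩ = φ_x J^x`. -/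
def pairing (φ J : Λ → ℝ) : ℝ := ∑ x, φ x * J x

/-- The component `δ^{|κ|} F / ∏_i δu_{x i}` at `u`. -/
def partialDeriv {κ : Type*} [Fintype κ] (F : (Λ → ℝ) → ℝ) (u : Λ → ℝ) (x : κ → Λ) : ℝ :=
  multiDeriv F u fun i => Pi.single (x i) 1

/-- The mean field `φ̄_x[J] = δW/δJ^x`. -/
def meanField (W : (Λ → ℝ) → ℝ) (J : Λ → ℝ) : Λ → ℝ := fun x => fderiv ℝ W J (Pi.single x 1)

/-- The tensor coefficients `Γ̄^x[J] = δ^{|κ|} Γ / ∏_i δφ_{x i}`, evaluated at `φ̄[J]`. -/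
def vertex {κ : Type*} [Fintype κ] (W : (Λ → ℝ) → ℝ) (J : Λ → ℝ) (x : κ → Λ) : ℝ :=
  partialDeriv (legendre pairing W) (meanField W J) x

/-- The contribution of a hierarchy, with propagator `g` and vertex coefficients `V`: a factor
`g_{z q}` for the edge above each node, where `z` is the label of the node (`y` at the root) and `q`
is the source label `x i` at a leaf `{i}`; and a factor `V^{q, z_B, …}` at each node that is not a
leaf, with one label `z_B` for each of its children `B`. All dummy labels are summed over `Λ`. -/
def treeAmplitude {ι : Type u} [DecidableEq ι] (g : Λ → Λ → ℝ)
    (V : (κ : Type u) → [Fintype κ] → (κ → Λ) → ℝ) (x : ι → Λ) :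
    {X : Finset ι} → Hierarchy X → Λ → ℝ
  | _, .leaf i, y => g y (x i)
  | _, .node P sub, y => ∑ p : Λ, ∑ z : P.1.parts → Λ,
      g y p * V (Option P.1.parts) (adjoin p z) * ∏ A, treeAmplitude g V x (sub A) (z A)

/-! ### States and cumulants -/

/-- The cumulants (Ursell functions) belonging to moments `m`, defined recursively by
`m(S) = ∑_{P ∈ 𝔓(S)} ∏_{A ∈ P} c(A)`. -/
def ursell {κ : Type u} [DecidableEq κ] (m : Finset κ → ℝ) (S : Finset κ) : ℝ :=
  m S - ∑ P : FinerPartition S, ∏ A : P.1.parts, ursell m A.1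
termination_by S.card
decreasing_by exact P.card_lt A.2

/-- The cumulant field moment `⟨⟨∏_{i ∈ κ} φ_{x i}⟩⟩` of the state `μ`. -/
def cumulant {κ : Type u} [Fintype κ] (μ : Measure (Λ → ℝ)) (x : κ → Λ) : ℝ := by
  classical
  exact ursell (fun S : Finset κ => ∫ φ, ∏ i ∈ S, φ (x i) ∂μ) Finset.univ

/-- `W[J] = ln Z[J]` with `Z[J] = ∫ e^{⟨φ, J⟩} dν(φ)`. -/
def logLaplace (ν : Measure (Λ → ℝ)) (J : Λ → ℝ) : ℝ :=
  Real.log (∫ φ, Real.exp (pairing φ J) ∂ν)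

/-- The state `ν^J` modified by the source `J`: `dν^J = Z[J]⁻¹ e^{⟨φ, J⟩} dν`. -/
def sourced (ν : Measure (Λ → ℝ)) (J : Λ → ℝ) : Measure (Λ → ℝ) :=
  ν.tilted fun φ => pairing φ J

end Components

/-! ### Index-free form on a Banach space of sources -/

section IndexFree

variable {E : Type v} [NormedAddCommGroup E] [NormedSpace ℝ E]

/-- The Legendre transform on the dual `E'` of the space `E` of sources. -/
def dualLegendre (W : E → ℝ) : StrongDual ℝ E → ℝ :=
  legendre (fun (φ : StrongDual ℝ E) (J : E) => φ J) W

/-- The index-free contribution of a hierarchy, as a covector: the open upper label of the tree is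
the argument of the covector, and contraction over a dummy label is insertion of a covector into a
slot of the vertex form. -/
def treeCovector {ι : Type u} [DecidableEq ι] (g : E →L[ℝ] StrongDual ℝ E)
    (V : (κ : Type u) → [Fintype κ] →
      ContinuousMultilinearMap ℝ (fun _ : κ => StrongDual ℝ E) ℝ) (h : ι → E) :
    {X : Finset ι} → Hierarchy X → StrongDual ℝ E
  | _, .leaf i => g (h i)
  | _, .node P sub =>
      ((V (Option P.1.parts)).toContinuousLinearMap
        (adjoin 0 fun A => treeCovector g V h (sub A)) none).comp g

end IndexFree

end

end FieldCalculus

/-! Write `φ̄ = DW`. Everything rests on one identity: for all `K` near `J` and every covector `ψ`,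
`DΓ[φ̄[K]](ψ) = -ψ(K)`. The right side is linear in `K`, so its derivatives of order at least two
vanish. Faà di Bruno's formula (`multisetDeriv_comp`) expands the same derivatives of the left side
as a sum over partitions of `X`, with derivatives of `Γ` as outer and of `φ̄` as inner factors. Take
`ψ = W''[J]k`. Differentiating the identity once gives `D²Γ(W''k, α) = -α(k)`, so the coarsest
partition contributes exactly `-D^{|X|+1}W(k, h_X)`. Solving for this term is formula (a)
(`multisetDeriv_expansion`). Iterating (a) on the smaller parts, and expanding by multilinearity,
gives the sum over hierarchies.

The identity comes from `dualLegendre_nhds`. Coercivity makes `W''[J]` invertible, so the inverse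
function theorem gives an analytic local inverse of `φ̄`, and hence analyticity of `Γ`. Since `Γ[φ]
+ φ(K) ≤ W[K]` near `φ̄[K]` with equality there, stationarity gives `DΓ`.

For a finite index set, positive definiteness implies coercivity by compactness, and the tensor
formulas are the Banach space formulas in coordinates. For cumulants, Faà di Bruno applied to `Z =
exp ∘ W` expresses the moments through derivatives of `W` by the very relation that defines
cumulants, so the two agree.

Derivatives are taken along multisets of directions: symmetry of higher derivatives makes any order
irrelevant, and subfamilies indexed by the parts of a partition then need no enumeration. -/

namespace FieldCalculus

noncomputable section

open Filter Topology

/-! ### Derivatives along multisets of directions -/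

section MultisetDerivative

variable {E F G : Type*} [NormedAddCommGroup E] [NormedSpace ℝ E]
  [NormedAddCommGroup F] [NormedSpace ℝ F] [NormedAddCommGroup G] [NormedSpace ℝ G]

/-- The mixed directional derivative of `f` at `u` along a multiset of directions. -/
def multisetDeriv (f : E → G) (u : E) (s : Multiset E) : G :=
  iteratedFDeriv ℝ s.toList.length f u s.toList.get

theorem analyticAt_iteratedFDeriv [CompleteSpace G] {f : E → G} {u : E} (hf : AnalyticAt ℝ f u)
    (n : ℕ) : AnalyticAt ℝ (iteratedFDeriv ℝ n f) u :=
  AnalyticOnNhd.iteratedFDeriv (s := {u}) (by rintro _ rfl; exact hf) n u rfl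

theorem iteratedFDeriv_get_cons [CompleteSpace G] {f : E → G} {u : E} (hf : AnalyticAt ℝ f u)
    (a : E) (l : List E) :
    iteratedFDeriv ℝ (a :: l).length f u (a :: l).get =
      fderiv ℝ (fun w => iteratedFDeriv ℝ l.length f w l.get) u a :=
  ((analyticAt_iteratedFDeriv hf l.length).differentiableAt).iteratedFDeriv_succ_apply_left'
    (m := (a :: l).get)

/-- Adjacent transpositions generate all permutations. A swap of the two leading directions is
symmetry of the derivative. A common leading direction is stripped off by differentiating the
inductive equality, which must therefore hold on a neighbourhood; hence the quantification over `u`.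
-/
theorem iteratedFDeriv_get_perm [CompleteSpace G] {f : E → G} {l l' : List E} (h : l.Perm l') :
    ∀ {u : E}, AnalyticAt ℝ f u →
      iteratedFDeriv ℝ l.length f u l.get = iteratedFDeriv ℝ l'.length f u l'.get := by
  induction h with
  | nil => intros; rfl
  | cons a _ ih =>
    intro u hf
    rw [iteratedFDeriv_get_cons hf, iteratedFDeriv_get_cons hf]
    congr 1
    refine EventuallyEq.fderiv_eq ?_
    filter_upwards [hf.eventually_analyticAt] with w hw using ih hw
  | swap a b l =>
    intro u hf
    have h := hf.contDiffAt (n := ⊤) |>.iteratedFDeriv_comp_perm (a :: b :: l).get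
      (Equiv.swap (0 : Fin (l.length + 2)) 1)
    refine Eq.trans ?_ h
    congr 1
    funext i
    refine Fin.cases ?_ (fun i => Fin.cases ?_ (fun i => ?_) i) i
    · simp
    · rw [Function.comp_apply]
      simp
    · rw [Function.comp_apply, Equiv.swap_apply_of_ne_of_ne] <;> simp [Fin.ext_iff]
  | trans _ _ ih₁ ih₂ => intro u hf; exact (ih₁ hf).trans (ih₂ hf)

theorem multisetDeriv_coe [CompleteSpace G] {f : E → G} {u : E} (hf : AnalyticAt ℝ f u)
    (l : List E) : multisetDeriv f u l = iteratedFDeriv ℝ l.length f u l.get :=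
  iteratedFDeriv_get_perm (Multiset.coe_eq_coe.1 (Multiset.coe_toList _)) hf

theorem multisetDeriv_zero (f : E → G) (u : E) : multisetDeriv f u 0 = f u := by
  have h : ∀ l : List E, l = [] → iteratedFDeriv ℝ l.length f u l.get = f u := by
    rintro _ rfl
    exact iteratedFDeriv_zero_apply _
  exact h _ Multiset.toList_zero

theorem multisetDeriv_cons [CompleteSpace G] {f : E → G} {u : E} (hf : AnalyticAt ℝ f u)
    (a : E) (s : Multiset E) :
    multisetDeriv f u (a ::ₘ s) = fderiv ℝ (fun w => multisetDeriv f w s) u a := by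
  induction s using Quotient.inductionOn with
  | _ l =>
  refine (multisetDeriv_coe hf (a :: l)).trans ((iteratedFDeriv_get_cons hf a l).trans ?_)
  congr 1
  refine EventuallyEq.fderiv_eq ?_
  filter_upwards [hf.eventually_analyticAt] with w hw using (multisetDeriv_coe hw l).symm

theorem multisetDeriv_singleton [CompleteSpace G] {f : E → G} {u : E} (hf : AnalyticAt ℝ f u)
    (a : E) : multisetDeriv f u {a} = fderiv ℝ f u a := by
  rw [← Multiset.cons_zero, multisetDeriv_cons hf]
  simp only [multisetDeriv_zero]

theorem analyticAt_multisetDeriv [CompleteSpace G] {f : E → G} {u : E} (hf : AnalyticAt ℝ f u)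
    (s : Multiset E) : AnalyticAt ℝ (fun w => multisetDeriv f w s) u := by
  induction s using Multiset.induction_on with
  | empty => simpa only [multisetDeriv_zero] using hf
  | cons a s ih =>
    refine AnalyticAt.congr (f := fun w => fderiv ℝ (fun w => multisetDeriv f w s) w a) ?_ ?_
    · exact ((ContinuousLinearMap.apply ℝ G a).analyticAt _).comp ih.fderiv
    · filter_upwards [hf.eventually_analyticAt] with w hw using (multisetDeriv_cons hw a s).symm

theorem multisetDeriv_congr {f g : E → G} {u : E} (h : f =ᶠ[𝓝 u] g) (s : Multiset E) :
    multisetDeriv f u s = multisetDeriv g u s := by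
  rw [multisetDeriv, multisetDeriv, EventuallyEq.eq_of_nhds (h.iteratedFDeriv ℝ _)]

theorem iteratedFDeriv_eq_multisetDeriv [CompleteSpace G] {f : E → G} {u : E}
    (hf : AnalyticAt ℝ f u) {n : ℕ} (m : Fin n → E) :
    iteratedFDeriv ℝ n f u m = multisetDeriv f u (Finset.univ.val.map m) := by
  obtain ⟨l, rfl, hl⟩ : ∃ l : List E, ∃ h : l.length = n, m = fun i => l.get (i.cast h.symm) :=
    ⟨List.ofFn m, by simp, by funext i; simp⟩
  have hm : m = l.get := hl
  subst hm
  have h : Finset.univ.val.map l.get = (l : Multiset E) := by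
    rw [Fin.univ_val_map, List.ofFn_get]
  rw [h, multisetDeriv_coe hf]

theorem multiDeriv_eq_multisetDeriv {κ : Type*} [Fintype κ] {f : E → ℝ} {u : E}
    (hf : AnalyticAt ℝ f u) (m : κ → E) :
    multiDeriv f u m = multisetDeriv f u (Finset.univ.val.map m) := by
  rw [multiDeriv, ContinuousMultilinearMap.domDomCongr_apply, iteratedFDeriv_eq_multisetDeriv hf]
  have h : (Finset.univ.val.map (Fintype.equivFin κ).symm) = (Finset.univ : Finset κ).val := by
    rw [← Finset.univ_map_equiv_to_embedding (Fintype.equivFin κ).symm]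
    rfl
  rw [← h, Multiset.map_map]
  rfl

theorem map_adjoin_univ {α κ : Type*} [Fintype κ] (a : α) (v : κ → α) :
    Finset.univ.val.map (adjoin a v) = a ::ₘ Finset.univ.val.map v := by
  rw [univ_option]
  simp [Finset.insertNone, adjoin, Multiset.map_map, Function.comp_def]

theorem map_univ_coe {α ι : Type*} (X : Finset ι) (h : ι → α) :
    (Finset.univ : Finset X).val.map (fun i : X => h i) = X.val.map h := by
  exact Multiset.attach_map_val' X.val h

/-- Derivatives of the mean field `DW` are covectors with one open slot; by symmetry, filling that
slot amounts to one more direction of differentiation. -/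
theorem multisetDeriv_fderiv_apply [CompleteSpace G] {f : E → G} {u : E} (hf : AnalyticAt ℝ f u)
    (s : Multiset E) (a : E) :
    multisetDeriv (fderiv ℝ f) u s a = multisetDeriv f u (a ::ₘ s) := by
  induction s using Multiset.induction_on generalizing u with
  | empty => rw [multisetDeriv_zero, multisetDeriv_cons hf]; simp only [multisetDeriv_zero]
  | cons b s ih =>
    rw [multisetDeriv_cons hf.fderiv, Multiset.cons_swap, multisetDeriv_cons hf]
    have h : (fun w => multisetDeriv f w (a ::ₘ s)) =ᶠ[𝓝 u]
        fun w => multisetDeriv (fderiv ℝ f) w s a := by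
      filter_upwards [hf.eventually_analyticAt] with w hw using (ih hw).symm
    rw [h.fderiv_eq, fderiv_clm_apply (analyticAt_multisetDeriv hf.fderiv s).differentiableAt
      (differentiableAt_const a)]
    simp

theorem analyticAt_clm_apply {f : E → F →L[ℝ] G} {u : E} (hf : AnalyticAt ℝ f u) (a : F) :
    AnalyticAt ℝ (fun w => f w a) u :=
  ((ContinuousLinearMap.apply ℝ G a).analyticAt _).comp hf

theorem multisetDeriv_clm_apply [CompleteSpace G] {f : E → F →L[ℝ] G} {u : E}
    (hf : AnalyticAt ℝ f u) (s : Multiset E) (a : F) :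
    multisetDeriv f u s a = multisetDeriv (fun w => f w a) u s := by
  induction s using Multiset.induction_on generalizing u with
  | empty => simp only [multisetDeriv_zero]
  | cons b s ih =>
    have h : (fun w => multisetDeriv (fun w => f w a) w s) =ᶠ[𝓝 u]
        fun w => multisetDeriv f w s a := by
      filter_upwards [hf.eventually_analyticAt] with w hw using (ih hw).symm
    rw [multisetDeriv_cons hf, multisetDeriv_cons (analyticAt_clm_apply hf a), h.fderiv_eq,
      fderiv_clm_apply (analyticAt_multisetDeriv hf s).differentiableAt (differentiableAt_const a)]
    simp

theorem multisetDeriv_comp_clm [CompleteSpace G] {f : F → G} (L : E →L[ℝ] F) {u : E}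
    (hf : AnalyticAt ℝ f (L u)) (s : Multiset E) :
    multisetDeriv (fun w => f (L w)) u s = multisetDeriv f (L u) (s.map L) := by
  induction s using Multiset.induction_on generalizing u with
  | empty => simp only [multisetDeriv_zero, Multiset.map_zero]
  | cons b s ih =>
    have h : (fun w => multisetDeriv (fun w => f (L w)) w s) =ᶠ[𝓝 u]
        (fun w => multisetDeriv f w (s.map L)) ∘ L := by
      filter_upwards [L.continuous.continuousAt.eventually hf.eventually_analyticAt] with w hw
        using ih hw
    rw [Multiset.map_cons, multisetDeriv_cons hf, multisetDeriv_cons (hf.fun_comp (L.analyticAt u)),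
      h.fderiv_eq, fderiv_comp _ (analyticAt_multisetDeriv hf _).differentiableAt
      L.differentiableAt]
    simp

theorem multisetDeriv_const [CompleteSpace G] (c : G) (u a : E) (s : Multiset E) :
    multisetDeriv (fun _ : E => c) u (a ::ₘ s) = 0 := by
  induction s using Multiset.induction_on generalizing u a with
  | empty => rw [multisetDeriv_cons analyticAt_const]; simp [multisetDeriv_zero]
  | cons b s ih =>
    rw [multisetDeriv_cons analyticAt_const]
    simp [ih]

/-- The derivative of a linear map is constant. This is what kills one side of Faà di Bruno's
formula as soon as `|X| ≥ 2`. -/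
theorem multisetDeriv_clm [CompleteSpace G] (L : E →L[ℝ] G) (u a b : E) (s : Multiset E) :
    multisetDeriv L u (a ::ₘ b ::ₘ s) = 0 := by
  rw [← multisetDeriv_fderiv_apply (L.analyticAt u)]
  have : fderiv ℝ L = fun _ => L := by funext w; exact L.fderiv
  rw [this, multisetDeriv_const]
  rfl

theorem multisetDeriv_exp (y : ℝ) (s : Multiset ℝ) :
    multisetDeriv Real.exp y s = Real.exp y * s.prod := by
  have h (w : ℝ) : AnalyticAt ℝ Real.exp w := analyticAt_rexp
  induction s using Multiset.induction_on generalizing y with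
  | empty => simp [multisetDeriv_zero]
  | cons b s ih =>
    rw [multisetDeriv_cons (h y)]
    simp only [ih]
    rw [fderiv_mul_const Real.differentiableAt_exp]
    simp
    ring

end MultisetDerivative

/-! ### The partitions of a set with one more element -/

section PartitionSum

variable {ι : Type u} [DecidableEq ι] {a : ι} {Y : Finset ι}

/-- The partition of `Y ∪ {a}` in which `a` joins the part `B`, or is a part of its own
if `B = ∅`. -/
def insertIntoPart (ha : a ∉ Y) (P : Finpartition Y) (B : Finset ι) (hB : B ∈ insert ∅ P.parts) :
    Finpartition (insert a Y) :=
  Finpartition.ofExistsUnique (insert (insert a B) (P.parts.erase B))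
    (by
      intro p hp
      rcases Finset.mem_insert.1 hp with rfl | hp
      · refine Finset.insert_subset_insert _ ?_
        rcases Finset.mem_insert.1 hB with rfl | hB
        · simp
        · exact P.subset hB
      · exact (P.subset (Finset.mem_of_mem_erase hp)).trans (Finset.subset_insert _ _))
    (by
      intro b hb
      have hsub : ∀ t ∈ P.parts, a ∉ t := fun t ht h => ha (P.subset ht h)
      rcases Finset.mem_insert.1 hb with rfl | hbY
      · refine ⟨insert b B, by simp, ?_⟩
        rintro t ⟨ht, hbt⟩
        rcases Finset.mem_insert.1 ht with rfl | ht
        · rfl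
        · exact absurd hbt (hsub t (Finset.mem_of_mem_erase ht))
      · have hba : b ≠ a := by rintro rfl; exact ha hbY
        obtain ⟨t, ⟨ht, hbt⟩, huniq⟩ := P.existsUnique_mem hbY
        by_cases htB : t = B
        · subst htB
          refine ⟨insert a t, by simp [hbt], ?_⟩
          rintro s ⟨hs, hbs⟩
          rcases Finset.mem_insert.1 hs with rfl | hs
          · rfl
          · exact absurd (huniq s ⟨Finset.mem_of_mem_erase hs, hbs⟩) (Finset.ne_of_mem_erase hs)
        · refine ⟨t, ⟨by simp [ht, htB], hbt⟩, ?_⟩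
          rintro s ⟨hs, hbs⟩
          rcases Finset.mem_insert.1 hs with rfl | hs
          · have hbB : b ∈ B := (Finset.mem_insert.1 hbs).resolve_left hba
            rcases Finset.mem_insert.1 hB with rfl | hB
            · simp at hbB
            · exact absurd (huniq B ⟨hB, hbB⟩).symm htB
          · exact huniq s ⟨Finset.mem_of_mem_erase hs, hbs⟩)
    (by
      intro h
      rcases Finset.mem_insert.1 h with h | h
      · exact Finset.insert_ne_empty _ _ h.symm
      · exact P.empty_notMem_parts (Finset.mem_of_mem_erase h))

theorem parts_insertIntoPart (ha : a ∉ Y) (P : Finpartition Y) (B : Finset ι)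
    (hB : B ∈ insert ∅ P.parts) :
    (insertIntoPart ha P B hB).parts = insert (insert a B) (P.parts.erase B) := rfl

/-- The part containing `a`, with `a` removed, recovers `B`; the remaining parts then recover `P`.
Because `∅` is never a part, it is free to encode the choice of a new part `{a}`. -/
theorem insertIntoPart_injective (ha : a ∉ Y) {P P' : Finpartition Y} {B B' : Finset ι}
    {hB : B ∈ insert ∅ P.parts} {hB' : B' ∈ insert ∅ P'.parts}
    (h : insertIntoPart ha P B hB = insertIntoPart ha P' B' hB') : P = P' ∧ B = B' := by
  have hp := congrArg Finpartition.parts h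
  rw [parts_insertIntoPart, parts_insertIntoPart] at hp
  have hsub : ∀ t ∈ P.parts, a ∉ t := fun t ht h => ha (P.subset ht h)
  have hsub' : ∀ t ∈ P'.parts, a ∉ t := fun t ht h => ha (P'.subset ht h)
  have haB : a ∉ B := by
    rcases Finset.mem_insert.1 hB with rfl | hB
    · simp
    · exact hsub _ hB
  have haB' : a ∉ B' := by
    rcases Finset.mem_insert.1 hB' with rfl | hB'
    · simp
    · exact hsub' _ hB'
  have hBB : B = B' := by
    have h1 : insert a B ∈ insert (insert a B') (P'.parts.erase B') := by rw [← hp]; simp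
    rcases Finset.mem_insert.1 h1 with h1 | h1
    · rw [← Finset.erase_insert haB, h1, Finset.erase_insert haB']
    · exact absurd (Finset.mem_insert_self _ _) (hsub' _ (Finset.mem_of_mem_erase h1))
  subst hBB
  refine ⟨?_, rfl⟩
  have hn : ∀ t, t ∈ P.parts.erase B ↔ t ∈ P'.parts.erase B := by
    intro t
    have h1 : ∀ t, a ∈ t → t ∉ P.parts.erase B ∧ t ∉ P'.parts.erase B := fun t ht =>
      ⟨fun h => hsub t (Finset.mem_of_mem_erase h) ht,
        fun h => hsub' t (Finset.mem_of_mem_erase h) ht⟩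
    by_cases hat : a ∈ t
    · simp only [h1 t hat]
    · have hne : t ≠ insert a B := by rintro rfl; simp at hat
      have := Finset.ext_iff.1 hp t
      simpa only [Finset.mem_insert, hne, false_or] using this
  refine Finpartition.ext (Finset.ext fun t => ?_)
  -- The two sets of parts agree away from `B`. If `B` is empty it is a part of neither, otherwise
  -- of both.
  have h0 := P.empty_notMem_parts
  have h0' := P'.empty_notMem_parts
  have := hn t
  simp only [Finset.mem_insert, Finset.mem_erase] at this hB hB'
  grind

theorem insertIntoPart_surjective (ha : a ∉ Y) (Q : Finpartition (insert a Y)) :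
    ∃ (P : Finpartition Y) (B : Finset ι) (hB : B ∈ insert ∅ P.parts),
      insertIntoPart ha P B hB = Q := by
  have haA : a ∈ Q.part a := Q.mem_part_self.2 (Finset.mem_insert_self _ _)
  have hA : Q.part a ∈ Q.parts := Q.part_mem.2 (Finset.mem_insert_self _ _)
  have huniq : ∀ t ∈ Q.parts, ∀ s ∈ Q.parts, ∀ b, b ∈ t → b ∈ s → t = s :=
    fun t ht s hs b hbt hbs => Q.eq_of_mem_parts ht hs hbt hbs
  have h0 := Q.empty_notMem_parts
  generalize Q.part a = A at haA hA
  -- Remove `a` from its part `A`. The final `erase ∅` discards the remainder when `A = {a}`.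
  let P : Finpartition Y := Finpartition.ofExistsUnique
    ((insert (A.erase a) (Q.parts.erase A)).erase ∅)
    (by
      intro p hp b hb
      have hsub : ∀ t ∈ Q.parts, t ⊆ insert a Y := fun t ht => Q.subset ht
      rcases Finset.mem_insert.1 (Finset.mem_of_mem_erase hp) with rfl | hp
      · have := hsub A hA (Finset.mem_of_mem_erase hb)
        exact (Finset.mem_insert.1 this).resolve_left (Finset.ne_of_mem_erase hb)
      · refine (Finset.mem_insert.1 (hsub p (Finset.mem_of_mem_erase hp) hb)).resolve_left ?_
        rintro rfl
        exact Finset.ne_of_mem_erase hp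
          (huniq p (Finset.mem_of_mem_erase hp) A hA b hb haA))
    (by
      intro b hb
      have hba : b ≠ a := by rintro rfl; exact ha hb
      obtain ⟨t, ⟨ht, hbt⟩, -⟩ := Q.existsUnique_mem (Finset.mem_insert_of_mem hb)
      by_cases htA : t = A
      · subst htA
        refine ⟨t.erase a, ⟨?_, by simp [hba, hbt]⟩, ?_⟩
        · refine Finset.mem_erase.2 ⟨?_, Finset.mem_insert_self _ _⟩
          exact Finset.ne_empty_of_mem (Finset.mem_erase.2 ⟨hba, hbt⟩)
        · rintro s ⟨hs, hbs⟩
          rcases Finset.mem_insert.1 (Finset.mem_of_mem_erase hs) with rfl | hs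
          · rfl
          · exact absurd (huniq s (Finset.mem_of_mem_erase hs) t ht b hbs hbt)
              (Finset.ne_of_mem_erase hs)
      · refine ⟨t, ⟨?_, hbt⟩, ?_⟩
        · exact Finset.mem_erase.2 ⟨Finset.ne_empty_of_mem hbt,
            Finset.mem_insert_of_mem (Finset.mem_erase.2 ⟨htA, ht⟩)⟩
        · rintro s ⟨hs, hbs⟩
          rcases Finset.mem_insert.1 (Finset.mem_of_mem_erase hs) with rfl | hs
          · exact absurd (huniq t ht A hA b hbt (Finset.mem_of_mem_erase hbs)) htA
          · exact huniq s (Finset.mem_of_mem_erase hs) t ht b hbs hbt)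
    (by simp)
  have hP : P.parts = (insert (A.erase a) (Q.parts.erase A)).erase ∅ := rfl
  have hB : A.erase a ∈ insert ∅ P.parts := by
    rw [hP]
    by_cases h : A.erase a = ∅
    · simp [h]
    · exact Finset.mem_insert_of_mem (Finset.mem_erase.2 ⟨h, Finset.mem_insert_self _ _⟩)
  refine ⟨P, A.erase a, hB, Finpartition.ext (Finset.ext fun t => ?_)⟩
  rw [parts_insertIntoPart, hP, Finset.insert_erase haA]
  -- By disjointness a non-empty remainder of `A` is not another part of `Q`, so erasing it later
  -- loses no original part.
  have hAe : A.erase a ∈ Q.parts.erase A → A.erase a = ∅ := by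
    intro h
    by_contra hne
    obtain ⟨b, hb⟩ := Finset.nonempty_iff_ne_empty.2 hne
    exact Finset.ne_of_mem_erase h
      (huniq _ (Finset.mem_of_mem_erase h) A hA b hb (Finset.mem_of_mem_erase hb))
  simp only [Finset.mem_insert, Finset.mem_erase] at hAe ⊢
  grind

/-- A sum over the partitions of `Y ∪ {a}`, in terms of the partitions of `Y`. -/
theorem sum_finpartition_insert {M : Type*} [AddCommMonoid M] (ha : a ∉ Y)
    (Φ : Finset (Finset ι) → M) :
    ∑ Q : Finpartition (insert a Y), Φ Q.parts =
      ∑ P : Finpartition Y, ∑ B ∈ insert ∅ P.parts,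
        Φ (insert (insert a B) (P.parts.erase B)) := by
  rw [Finset.sum_sigma']
  refine (Finset.sum_bij (fun p hp => insertIntoPart ha p.1 p.2 (Finset.mem_sigma.1 hp).2)
    (fun _ _ => Finset.mem_univ _) ?_ ?_ (fun _ _ => rfl)).symm
  · rintro ⟨P, B⟩ _ ⟨P', B'⟩ _ h
    obtain ⟨rfl, rfl⟩ := insertIntoPart_injective ha h
    rfl
  · intro Q _
    obtain ⟨P, B, hB, h⟩ := insertIntoPart_surjective ha Q
    exact ⟨⟨P, B⟩, Finset.mem_sigma.2 ⟨Finset.mem_univ _, hB⟩, h⟩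

theorem sum_finpartition_eq_top_add {M : Type*} [AddCommMonoid M] {X : Finset ι}
    (hX : X.Nonempty) (Φ : Finset (Finset ι) → M) :
    ∑ Q : Finpartition X, Φ Q.parts = Φ {X} + ∑ P : FinerPartition X, Φ P.1.parts := by
  have htop : (⊤ : Finpartition X).parts = {X} := by
    have h : (⊤ : Finpartition X).parts.Nonempty :=
      (⊤ : Finpartition X).parts_nonempty hX.ne_empty
    exact h.subset_singleton_iff.1 (Finpartition.parts_top_subset X)
  rw [← htop, Fintype.sum_eq_add_sum_compl (⊤ : Finpartition X)]
  congr 1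
  rw [Finset.sum_subtype (p := fun P => P ≠ ⊤) _ (by simp)]

end PartitionSum

/-! ### Faà di Bruno's formula -/

section FaaDiBruno

variable {E F G : Type*} [NormedAddCommGroup E] [NormedSpace ℝ E]
  [NormedAddCommGroup F] [NormedSpace ℝ F] [NormedAddCommGroup G] [NormedSpace ℝ G]

/-- Product rule: the derivative falls either on the base point, creating a new argument, or on one
of the arguments. In the induction for Faà di Bruno these are the cases where the new element forms
its own part or joins an existing one. -/
theorem differentiableAt_and_fderiv_multisetDeriv_comp [CompleteSpace G] {α : Type*} [DecidableEq α]
    {g : F → G} {f : E → F} {x : E}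
    (hf : AnalyticAt ℝ f x) (hg : AnalyticAt ℝ g (f x)) (S : Finset α) {v : α → E → F}
    (hv : ∀ i, AnalyticAt ℝ (v i) x) :
    DifferentiableAt ℝ (fun w => multisetDeriv g (f w) (S.val.map fun i => v i w)) x ∧ ∀ a,
    fderiv ℝ (fun w => multisetDeriv g (f w) (S.val.map fun i => v i w)) x a =
      multisetDeriv g (f x) (fderiv ℝ f x a ::ₘ S.val.map fun i => v i x) +
        ∑ i ∈ S, multisetDeriv g (f x)
          (fderiv ℝ (v i) x a ::ₘ (S.erase i).val.map fun i => v i x) := by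
  obtain ⟨n, e, rfl⟩ : ∃ (n : ℕ) (e : Fin n ↪ α), S = Finset.univ.map e :=
    ⟨S.card, S.equivFin.symm.toEmbedding.trans (Function.Embedding.subtype _), by
      rw [← Finset.map_map, Finset.univ_map_equiv_to_embedding, Finset.univ_eq_attach,
        Finset.attach_map_val]⟩
  have hev : (fun w => multisetDeriv g (f w) ((Finset.univ.map e).val.map fun i => v i w)) =ᶠ[𝓝 x]
      fun w => iteratedFDeriv ℝ n g (f w) fun j => v (e j) w := by
    filter_upwards [hf.continuousAt.eventually hg.eventually_analyticAt] with w hw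
    rw [iteratedFDeriv_eq_multisetDeriv hw, Finset.map_val, Multiset.map_map]
    rfl
  have hD := HasFDerivAt.continuousMultilinearMap_apply
    ((analyticAt_iteratedFDeriv hg n).differentiableAt.hasFDerivAt.comp x
      hf.differentiableAt.hasFDerivAt)
    fun j => (hv (e j)).differentiableAt.hasFDerivAt
  have hD' := hD.congr_of_eventuallyEq hev
  refine ⟨hD'.differentiableAt, fun a => ?_⟩
  rw [hD'.fderiv, Finset.sum_map, add_apply, sum_apply]
  congr 1
  · rw [Finset.map_val, Multiset.map_map]
    have := iteratedFDeriv_eq_multisetDeriv hg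
      (Fin.cons (fderiv ℝ f x a) fun j => v (e j) x : Fin (n + 1) → F)
    rw [iteratedFDeriv_succ_apply_left] at this
    refine Eq.trans this ?_
    congr 1
    rw [Fin.univ_succ, Finset.cons_val, Multiset.map_cons, Finset.map_val, Multiset.map_map]
    rfl
  · refine Finset.sum_congr rfl fun j _ => ?_
    refine (iteratedFDeriv_eq_multisetDeriv hg
      (Function.update (fun j => v (e j) x) j (fderiv ℝ (v (e j)) x a))).trans ?_
    congr 1
    have hu : (Finset.univ : Finset (Fin n)).val = j ::ₘ (Finset.univ.erase j).val := by
      rw [← Finset.insert_val_of_notMem (Finset.notMem_erase _ _),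
        Finset.insert_erase (Finset.mem_univ j)]
    rw [← Finset.map_erase, Finset.map_val, Multiset.map_map, hu, Multiset.map_cons,
      Function.update_self]
    congr 1
    refine Multiset.map_congr (by simp) fun i hi => ?_
    rw [Function.update_of_ne (Finset.ne_of_mem_erase (s := Finset.univ) hi)]
    rfl

/-- **Faà di Bruno's formula** as a sum over partitions. -/
theorem multisetDeriv_comp [CompleteSpace F] [CompleteSpace G] {ι : Type*} [DecidableEq ι]
    {g : F → G} {f : E → F} {x : E}
    (hf : AnalyticAt ℝ f x) (hg : AnalyticAt ℝ g (f x)) (X : Finset ι) (h : ι → E) :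
    multisetDeriv (fun w => g (f w)) x (X.val.map h) =
      ∑ P : Finpartition X, multisetDeriv g (f x)
        (P.parts.val.map fun A => multisetDeriv f x (A.val.map h)) := by
  induction X using Finset.induction_on generalizing x with
  | empty =>
    have hu := Fintype.sum_unique fun P : Finpartition (⊥ : Finset ι) => multisetDeriv g (f x)
      (P.parts.val.map fun A => multisetDeriv f x (A.val.map h))
    rw [Finpartition.parts_eq_empty_iff.2 rfl] at hu
    refine Eq.trans ?_ hu.symm
    simp [multisetDeriv_zero]
  | insert a Y ha ih =>
    have hev : (fun w => multisetDeriv (fun w => g (f w)) w (Y.val.map h)) =ᶠ[𝓝 x]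
        fun w => ∑ P : Finpartition Y, multisetDeriv g (f w)
          (P.parts.val.map fun A => multisetDeriv f w (A.val.map h)) := by
      filter_upwards [hf.eventually_analyticAt,
        hf.continuousAt.eventually hg.eventually_analyticAt] with w hw hw' using ih hw hw'
    have hA : ∀ A : Finset ι, AnalyticAt ℝ (fun w => multisetDeriv f w (A.val.map h)) x :=
      fun A => analyticAt_multisetDeriv hf _
    have hins : ∀ A : Finset ι, a ∉ A →
        multisetDeriv f x ((insert a A).val.map h) =
          fderiv ℝ (fun w => multisetDeriv f w (A.val.map h)) x (h a) := by
      intro A haA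
      rw [Finset.insert_val_of_notMem haA, Multiset.map_cons, multisetDeriv_cons hf]
    rw [Finset.insert_val_of_notMem ha, Multiset.map_cons,
      multisetDeriv_cons (hg.fun_comp hf), hev.fderiv_eq,
      sum_finpartition_insert ha fun p => multisetDeriv g (f x)
        (p.val.map fun A => multisetDeriv f x (A.val.map h)), fderiv_fun_sum]
    · rw [sum_apply]
      refine Finset.sum_congr rfl fun P _ => ?_
      have hsub : ∀ t ∈ P.parts, a ∉ t := fun t ht h => ha (P.subset ht h)
      rw [(differentiableAt_and_fderiv_multisetDeriv_comp hf hg P.parts hA).2,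
        Finset.sum_insert P.empty_notMem_parts]
      -- `B = ∅` matches the base-point term of the product rule, and a part `B` matches the term in
      -- which its factor is differentiated.
      have hterm : ∀ B ∈ insert ∅ P.parts,
          multisetDeriv g (f x) ((insert (insert a B) (P.parts.erase B)).val.map
            fun A => multisetDeriv f x (A.val.map h)) =
          multisetDeriv g (f x) (fderiv ℝ (fun w => multisetDeriv f w (B.val.map h)) x (h a) ::ₘ
            (P.parts.erase B).val.map fun A => multisetDeriv f x (A.val.map h)) := by
        intro B hB
        have haB : a ∉ B := by
          rcases Finset.mem_insert.1 hB with rfl | hB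
          · simp
          · exact hsub _ hB
        rw [Finset.insert_val_of_notMem, Multiset.map_cons, hins B haB]
        exact fun h => hsub _ (Finset.mem_of_mem_erase h) (Finset.mem_insert_self _ _)
      congr 1
      · rw [hterm _ (Finset.mem_insert_self _ _), Finset.erase_eq_of_notMem P.empty_notMem_parts]
        simp only [Finset.empty_val, Multiset.map_zero, multisetDeriv_zero]
      · exact Finset.sum_congr rfl fun B hB => (hterm B (Finset.mem_insert_of_mem hB)).symm
    · exact fun P _ => (differentiableAt_and_fderiv_multisetDeriv_comp hf hg P.parts hA).1

end FaaDiBruno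

/-! ### The Legendre transform near a nondegenerate source -/

section Legendre

variable {E : Type*} [NormedAddCommGroup E] [NormedSpace ℝ E]

/-- The Riesz representation theorem for a coercive symmetric form on a Banach space. -/
theorem surjective_of_isCoercive_of_symm [CompleteSpace E] (H : E →L[ℝ] StrongDual ℝ E)
    (hH : IsCoercive H) (hsymm : ∀ a b, H a b = H b a) : Function.Surjective H := by
  intro ψ
  obtain ⟨c, hc, hcoer⟩ := hH
  -- The critical points of this quadratic functional are the solutions of `H h = ψ`; a minimizer is
  -- constructed directly from completeness.
  let q : E → ℝ := fun h => H h h / 2 - ψ h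
  have hq : Continuous q := by fun_prop
  have hexp : ∀ a b : E, q (a + b) = q a + (H a b - ψ b) + H b b / 2 := by
    intro a b
    simp only [q, map_add, add_apply, hsymm b a]
    ring
  have hbdd : BddBelow (Set.range q) := by
    -- The minimum over `r = ‖h‖` of `c r² / 2 - ‖ψ‖ r`, found by completing the square.
    refine ⟨-(‖ψ‖ ^ 2 / (2 * c)), ?_⟩
    rintro _ ⟨h, rfl⟩
    have h1 := hcoer h
    have h2 : ψ h ≤ ‖ψ‖ * ‖h‖ := (le_abs_self _).trans (ψ.le_opNorm h)
    have h3 : 0 ≤ (c * ‖h‖ - ‖ψ‖) ^ 2 / (2 * c) := by positivity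
    have h4 : (c * ‖h‖ - ‖ψ‖) ^ 2 / (2 * c) =
        c * ‖h‖ * ‖h‖ / 2 - ‖ψ‖ * ‖h‖ + ‖ψ‖ ^ 2 / (2 * c) := by field_simp; ring
    simp only [q]
    linarith
  set m := ⨅ h, q h with hm
  have hmle : ∀ h, m ≤ q h := fun h => ciInf_le hbdd h
  -- Parallelogram identity: the midpoint of two near-minimizers cannot go below `m`, so they are
  -- close. Minimizing sequences are therefore Cauchy.
  have hdist : ∀ a b, c * ‖a - b‖ * ‖a - b‖ / 8 ≤ (q a - m + (q b - m)) / 2 := by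
    intro a b
    have h1 := hcoer (a - b)
    have h2 := hmle ((1 / 2 : ℝ) • (a + b))
    have h3 : q ((1 / 2 : ℝ) • (a + b)) = (q a + q b) / 2 - H (a - b) (a - b) / 8 := by
      simp only [q, map_add, map_sub, add_apply, sub_apply, smul_apply, map_smul, smul_eq_mul,
        hsymm b a]
      ring
    linarith
  have hex : ∀ n : ℕ, ∃ h, q h < m + 1 / ((n : ℝ) + 1) := fun n =>
    exists_lt_of_ciInf_lt (lt_add_of_pos_right m (by positivity))
  choose w hw using hex
  have hcauchy : CauchySeq w := by
    refine Metric.cauchySeq_iff'.2 fun ε hε => ?_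
    obtain ⟨N, hN⟩ := exists_nat_one_div_lt (show 0 < c * ε * ε / 8 by positivity)
    refine ⟨N, fun n hn => ?_⟩
    rw [dist_eq_norm]
    by_contra! hlt
    have h1 := hdist (w n) (w N)
    have h2 := hw n
    have h3 := hw N
    have h4 : 1 / ((n : ℝ) + 1) ≤ 1 / ((N : ℝ) + 1) := by gcongr
    have h5 : c * ε * ε ≤ c * ‖w n - w N‖ * ‖w n - w N‖ := by gcongr
    linarith
  obtain ⟨h, hlim⟩ := cauchySeq_tendsto_of_complete hcauchy
  have hmin : q h ≤ m := by
    refine le_of_tendsto_of_tendsto ((hq.tendsto h).comp hlim)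
      (g := fun n : ℕ => m + 1 / ((n : ℝ) + 1)) ?_ (Eventually.of_forall fun n => (hw n).le)
    simpa using (tendsto_one_div_add_atTop_nhds_zero_nat (𝕜 := ℝ)).const_add m
  refine ⟨h, ContinuousLinearMap.ext fun k => ?_⟩
  have hlin : IsLocalMin (fun t : ℝ => q h + t * (H h k - ψ k) + t ^ 2 * (H k k / 2)) 0 := by
    refine Eventually.of_forall fun t => ?_
    have h1 := hmin.trans (hmle (h + t • k))
    rw [hexp] at h1
    simp only [map_smul, smul_apply, smul_eq_mul] at h1
    simp only
    linarith
  have hd : HasDerivAt (fun t : ℝ => q h + t * (H h k - ψ k) + t ^ 2 * (H k k / 2))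
      (H h k - ψ k) 0 := by
    have h1 := (((hasDerivAt_id (0 : ℝ)).mul_const (H h k - ψ k)).const_add (q h)).fun_add
      (((hasDerivAt_id (0 : ℝ)).fun_pow 2).mul_const (H k k / 2))
    simpa using h1
  exact sub_eq_zero.1 (hlin.hasDerivAt_eq_zero hd)

/-- A convex function lies above its tangents, as seen by restricting to a line. Strictness follows
from the tangent inequality at the midpoint of `J` and `K`, where strict convexity leaves a gap. -/
theorem IsStrictlyConvexAnalytic.sub_fderiv_lt {W : E → ℝ} (hW : IsStrictlyConvexAnalytic W)
    {J K : E} (hK : K ≠ J) : W J - fderiv ℝ W J J < W K - fderiv ℝ W J K := by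
  have hle : ∀ K, fderiv ℝ W J (K - J) ≤ W K - W J := by
    intro K
    have hconv : ConvexOn ℝ Set.univ (W ∘ AffineMap.lineMap (k := ℝ) J K) := by
      simpa using hW.strictConvex.convexOn.comp_affineMap (AffineMap.lineMap (k := ℝ) J K)
    have hd : HasDerivAt (W ∘ AffineMap.lineMap (k := ℝ) J K) (fderiv ℝ W J (K - J)) 0 := by
      have h1 : HasFDerivAt W (fderiv ℝ W J) (AffineMap.lineMap (k := ℝ) J K 0) := by
        rw [AffineMap.lineMap_apply_zero]
        exact (hW.analytic J trivial).differentiableAt.hasFDerivAt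
      exact h1.comp_hasDerivAt 0 AffineMap.hasDerivAt_lineMap
    have := hconv.deriv_le_slope (Set.mem_univ 0) (Set.mem_univ 1) one_pos hd.differentiableAt
    rw [hd.deriv, slope_def_field] at this
    simpa using this
  have h1 := hle ((1 / 2 : ℝ) • J + (1 / 2 : ℝ) • K)
  have h2 := hW.strictConvex.2 (Set.mem_univ J) (Set.mem_univ K) hK.symm
    (show (0 : ℝ) < 1 / 2 by norm_num) (show (0 : ℝ) < 1 / 2 by norm_num) (by norm_num)
  simp only [map_add, map_sub, map_smul, smul_eq_mul] at h1 h2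
  linarith

/-- Guards against the default value of a real infimum: `ciInf_le` is available for `Γ` only at
covectors of the form `DW[J]`. -/
theorem IsStrictlyConvexAnalytic.bddBelow {W : E → ℝ} (hW : IsStrictlyConvexAnalytic W) (J : E) :
    BddBelow (Set.range fun K => W K - fderiv ℝ W J K) := by
  refine ⟨W J - fderiv ℝ W J J, ?_⟩
  rintro _ ⟨K, rfl⟩
  rcases eq_or_ne K J with rfl | h
  · exact le_rfl
  · exact (hW.sub_fderiv_lt h).le

theorem IsStrictlyConvexAnalytic.dualLegendre_fderiv {W : E → ℝ} (hW : IsStrictlyConvexAnalytic W)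
    (J : E) : dualLegendre W (fderiv ℝ W J) = W J - fderiv ℝ W J J := by
  refine le_antisymm (ciInf_le (hW.bddBelow J) J) (le_ciInf fun K => ?_)
  rcases eq_or_ne K J with rfl | h
  · exact le_rfl
  · exact (hW.sub_fderiv_lt h).le

theorem hessian_symm {W : E → ℝ} {J : E} (hW : AnalyticAt ℝ W J) (a b : E) :
    hessian W J a b = hessian W J b a :=
  (hW.contDiffAt (n := ⊤)).isSymmSndFDerivAt (by simp) a b

/-- `Γ` is analytic near the mean field, and its derivative is minus the inverse of the map from
sources to mean fields. -/
theorem IsStrictlyConvexAnalytic.dualLegendre_nhds [CompleteSpace E] {W : E → ℝ}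
    (hW : IsStrictlyConvexAnalytic W) {J : E} (hJ : IsCoercive (hessian W J)) :
    AnalyticAt ℝ (dualLegendre W) (fderiv ℝ W J) ∧
      ∀ᶠ K in 𝓝 J, ∀ ψ : StrongDual ℝ E, fderiv ℝ (dualLegendre W) (fderiv ℝ W K) ψ = -ψ K := by
  have han : AnalyticAt ℝ (fderiv ℝ W) J := (hW.analytic J trivial).fderiv
  have hinj : Function.Injective (hessian W J) := by
    refine (injective_iff_map_eq_zero _).2 fun h hh => ?_
    obtain ⟨c, hc, hcoer⟩ := hJ
    have h1 := hcoer h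
    rw [hh, zero_apply] at h1
    by_contra hne
    have : 0 < ‖h‖ := norm_pos_iff.2 hne
    have : 0 < c * ‖h‖ * ‖h‖ := by positivity
    linarith
  have hsurj := surjective_of_isCoercive_of_symm _ hJ (hessian_symm (hW.analytic J trivial))
  let e : E ≃L[ℝ] StrongDual ℝ E := ContinuousLinearEquiv.ofBijective (hessian W J)
    (LinearMap.ker_eq_bot.2 hinj) (LinearMap.range_eq_top.2 hsurj)
  have he : fderiv ℝ (fderiv ℝ W) J = e := by
    ext1 h
    rfl
  have hstrict : HasStrictFDerivAt (fderiv ℝ W) (e : E →L[ℝ] StrongDual ℝ E) J :=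
    he ▸ han.hasStrictFDerivAt
  let R := hstrict.toOpenPartialHomeomorph (fderiv ℝ W)
  have hR : ∀ K, R K = fderiv ℝ W K := fun K => rfl
  have hsource : J ∈ R.source := hstrict.mem_toOpenPartialHomeomorph_source
  have htarget : R.target ∈ 𝓝 (fderiv ℝ W J) :=
    R.open_target.mem_nhds (R.map_source hsource)
  have hsymm : AnalyticAt ℝ R.symm (fderiv ℝ W J) := R.analyticAt_symm' hsource han he
  have hΓ : AnalyticAt ℝ (dualLegendre W) (fderiv ℝ W J) := by
    -- Near the mean field the infimum is attained at the source `R.symm φ`, which depends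
    -- analytically on `φ`.
    refine AnalyticAt.congr (f := fun φ => W (R.symm φ) - φ (R.symm φ)) ?_ ?_
    · refine AnalyticAt.sub ((hW.analytic _ trivial).comp hsymm) ?_
      exact ((ContinuousLinearMap.id ℝ (StrongDual ℝ E)).analyticAt_bilinear _).comp
        (analyticAt_id.prod hsymm)
    · filter_upwards [htarget] with φ hφ
      have : fderiv ℝ W (R.symm φ) = φ := R.right_inv hφ
      conv_rhs => rw [← this, hW.dualLegendre_fderiv, this]
  refine ⟨hΓ, ?_⟩
  filter_upwards [han.continuousAt.eventually hΓ.eventually_analyticAt,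
    han.continuousAt.eventually (eventually_mem_nhds_iff.2 htarget)] with K hK hKt ψ
  -- For fixed `K`, `Γ[φ] + φ(K)` is at most `W[K]`, with equality at `φ = DW[K]`. Stationarity
  -- there gives the derivative of `Γ` without differentiating the inverse map.
  have hmax : IsLocalMax (fun φ : StrongDual ℝ E => dualLegendre W φ + φ K) (fderiv ℝ W K) := by
    filter_upwards [hKt] with φ hφ
    have h1 : fderiv ℝ W (R.symm φ) = φ := R.right_inv hφ
    have h2 : dualLegendre W φ ≤ W K - φ K := ciInf_le (h1 ▸ hW.bddBelow (R.symm φ)) K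
    rw [hW.dualLegendre_fderiv]
    linarith
  have hd : HasFDerivAt (fun φ : StrongDual ℝ E => dualLegendre W φ + φ K)
      (fderiv ℝ (dualLegendre W) (fderiv ℝ W K) + ContinuousLinearMap.apply ℝ ℝ K)
      (fderiv ℝ W K) :=
    hK.differentiableAt.hasFDerivAt.add (ContinuousLinearMap.apply ℝ ℝ K).hasFDerivAt
  have := DFunLike.congr_fun (hmax.hasFDerivAt_eq_zero hd) ψ
  rw [add_apply] at this
  exact eq_neg_of_add_eq_zero_left this

end Legendre

/-! ### The expansion on a Banach space of sources -/

section Expansion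

/-- A sum over the hierarchies on a set with at least two elements, by the children of the root. -/
theorem sum_hierarchy_of_two_le {ι : Type u} [DecidableEq ι] {X : Finset ι} (hX : 2 ≤ X.card)
    {M : Type*} [AddCommMonoid M] (Φ : Hierarchy X → M) :
    ∑ H : Hierarchy X, Φ H =
      ∑ P : FinerPartition X, ∑ sub : ∀ A : P.1.parts, Hierarchy A.1, Φ (.node P sub) := by
  rw [← Fintype.sum_sigma']
  refine (Fintype.sum_bijective
    (fun p : Σ P : FinerPartition X, ∀ A : P.1.parts, Hierarchy A.1 => Hierarchy.node p.1 p.2)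
    ⟨?_, ?_⟩ _ _ fun _ => rfl).symm
  · rintro ⟨P, s⟩ ⟨Q, t⟩ h
    injection h with _ h1 h2
    exact Sigma.ext h1 h2
  · intro H
    cases H with
    | leaf i => simp at hX
    | node P sub => exact ⟨⟨P, sub⟩, rfl⟩

/-- A singleton carries exactly one hierarchy. -/
theorem sum_hierarchy_singleton {ι : Type u} [DecidableEq ι] (i : ι) {M : Type*} [AddCommMonoid M]
    (Φ : Hierarchy {i} → M) : ∑ H : Hierarchy {i}, Φ H = Φ (.leaf i) := by
  refine Fintype.sum_eq_single _ fun H hH => (hH ?_).elim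
  -- The index becomes a variable so that `cases` can match on the hierarchy.
  have h : ∀ {Y : Finset ι} (K : Hierarchy Y) (hY : Y = {i}),
      hY ▸ K = Hierarchy.leaf i := by
    intro Y K hY
    cases K with
    | leaf j =>
      obtain rfl := Finset.singleton_injective hY
      rfl
    | node P sub =>
      exfalso
      -- Non-empty subsets of `{i}` equal `{i}`, so the only partition of a singleton is `⊤`, which
      -- `P` excludes.
      refine P.2 (top_le_iff.1 fun B hB => ?_)
      have hsub : B ⊆ {i} := hY ▸ (⊤ : Finpartition Y).subset hB
      have hB1 : B = {i} :=
        ((Finset.subset_singleton_iff.1 hsub).resolve_left ((⊤ : Finpartition Y).ne_empty hB))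
      obtain ⟨A, hA⟩ := P.1.parts_nonempty (by rw [hY]; exact Finset.singleton_ne_empty i)
      have hA1 : A = {i} :=
        ((Finset.subset_singleton_iff.1 (hY ▸ P.1.subset hA)).resolve_left (P.1.ne_empty hA))
      exact ⟨A, hA, by rw [hB1, hA1]⟩
  exact h H rfl

variable {E : Type v} [NormedAddCommGroup E] [NormedSpace ℝ E]

/-- The `0` placed at `none` in `openDeriv` and `treeCovector` is a placeholder, overwritten by the
argument of the open slot. -/
theorem update_adjoin_none {α κ : Type*} [DecidableEq (Option κ)] (a b : α) (v : κ → α) :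
    Function.update (adjoin a v) none b = adjoin b v := by
  funext o
  cases o with
  | none => simp [adjoin]
  | some i => rw [Function.update_of_ne (by simp)]; rfl

theorem adjoin_update {α κ : Type*} [DecidableEq κ] [DecidableEq (Option κ)] (a b : α)
    (v : κ → α) (i : κ) :
    adjoin a (Function.update v i b) = Function.update (adjoin a v) (some i) b := by
  funext o
  cases o with
  | none => rw [Function.update_of_ne (by simp)]; rfl
  | some j =>
    by_cases h : j = i
    · subst h; simp [adjoin]
    · rw [Function.update_of_ne (by simpa using h)]
      simp [adjoin, h]

/-- A multilinear form with its additional argument frozen. -/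
def freezeNone {κ : Type*} (V : ContinuousMultilinearMap ℝ (fun _ : Option κ => E) ℝ) (a : E) :
    MultilinearMap ℝ (fun _ : κ => E) ℝ where
  toFun v := V (adjoin a v)
  map_update_add' v i x y := by
    classical
    simp only [adjoin_update, V.map_update_add]
  map_update_smul' v i c x := by
    classical
    simp only [adjoin_update, V.map_update_smul]

theorem openDeriv_apply {κ : Type*} [Fintype κ] (F : E → ℝ) (u : E) (h : κ → E) (k : E) :
    openDeriv F u h k = multiDeriv F u (adjoin k h) := by
  classical
  rw [openDeriv, ContinuousMultilinearMap.toContinuousLinearMap_apply, update_adjoin_none]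

theorem multiDeriv_adjoin {κ : Type*} [Fintype κ] {F : E → ℝ} {u : E} (hF : AnalyticAt ℝ F u)
    (k : E) (h : κ → E) :
    multiDeriv F u (adjoin k h) = multisetDeriv F u (k ::ₘ Finset.univ.val.map h) := by
  rw [multiDeriv_eq_multisetDeriv hF, map_adjoin_univ]

/-- Identifies the open-slot derivatives of `W` with the inner derivatives of `φ̄ = DW` that Faà di
Bruno's formula produces. -/
theorem openDeriv_eq_multisetDeriv {ι : Type*} {F : E → ℝ} {u : E}
    (hF : AnalyticAt ℝ F u) (X : Finset ι) (h : ι → E) :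
    openDeriv F u (fun i : X => h i) = multisetDeriv (fderiv ℝ F) u (X.val.map h) := by
  ext k
  rw [openDeriv_apply, multiDeriv_adjoin hF, map_univ_coe, multisetDeriv_fderiv_apply hF]

theorem treeCovector_node_apply {ι : Type u} [DecidableEq ι] (g : E →L[ℝ] StrongDual ℝ E)
    (V : (κ : Type u) → [Fintype κ] →
      ContinuousMultilinearMap ℝ (fun _ : κ => StrongDual ℝ E) ℝ) (h : ι → E) {X : Finset ι}
    (P : FinerPartition X) (sub : ∀ A : P.1.parts, Hierarchy A.1) (k : E) :
    treeCovector g V h (.node P sub) k =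
      V (Option P.1.parts) (adjoin (g k) fun A => treeCovector g V h (sub A)) := by
  rw [treeCovector, ContinuousLinearMap.comp_apply,
    ContinuousMultilinearMap.toContinuousLinearMap_apply, update_adjoin_none]

variable [CompleteSpace E] {W : E → ℝ} {J : E} {ι : Type u} [DecidableEq ι]

/-- Differentiate `DΓ[φ̄[K]](ψ) = -ψ(K)` along `h_X` at `K = J`, and isolate the coarsest partition.
-/
theorem IsStrictlyConvexAnalytic.multisetDeriv_expansion (hW : IsStrictlyConvexAnalytic W)
    (hJ : IsCoercive (hessian W J)) (X : Finset ι) (hX : 2 ≤ X.card) (h : ι → E) (k : E) :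
    multisetDeriv W J (k ::ₘ X.val.map h) = ∑ P : FinerPartition X,
      multisetDeriv (dualLegendre W) (fderiv ℝ W J) (hessian W J k ::ₘ
        P.1.parts.val.map fun A => multisetDeriv (fderiv ℝ W) J (A.val.map h)) := by
  obtain ⟨hΓ, hD⟩ := hW.dualLegendre_nhds hJ
  have hWJ : AnalyticAt ℝ W J := hW.analytic J trivial
  have hg : ∀ ψ, AnalyticAt ℝ (fun φ => fderiv ℝ (dualLegendre W) φ ψ) (fderiv ℝ W J) := fun ψ =>
    analyticAt_clm_apply hΓ.fderiv ψ
  have hcomp : ∀ ψ : StrongDual ℝ E,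
      (fun K => fderiv ℝ (dualLegendre W) (fderiv ℝ W K) ψ) =ᶠ[𝓝 J] ⇑(-ψ) := by
    intro ψ
    filter_upwards [hD] with K hK using hK ψ
  -- The covector `ψ = W''[J]k` stays fixed while the source varies; this choice turns the coarsest
  -- term into the derivative sought.
  have hfaa := multisetDeriv_comp hWJ.fderiv (hg (hessian W J k)) X h
  rw [multisetDeriv_congr (hcomp _)] at hfaa
  obtain ⟨a, Y, ha, rfl, hY⟩ : ∃ a Y, a ∉ Y ∧ insert a Y = X ∧ Y.card = X.card - 1 := by
    obtain ⟨a, haX⟩ := Finset.card_pos.1 (by omega : 0 < X.card)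
    exact ⟨a, X.erase a, by simp, Finset.insert_erase haX, Finset.card_erase_of_mem haX⟩
  obtain ⟨b, hb⟩ := Finset.card_pos.1 (by omega : 0 < Y.card)
  -- Two elements `a`, `b` of `X` exhibit a derivative of order at least two of a linear map.
  have hzero : multisetDeriv (⇑(-hessian W J k)) J ((insert a Y).val.map h) = 0 := by
    rw [Finset.insert_val_of_notMem ha, ← Finset.insert_erase hb,
      Finset.insert_val_of_notMem (Finset.notMem_erase b Y), Multiset.map_cons, Multiset.map_cons,
      multisetDeriv_clm]
  have hpush : ∀ s ψ, multisetDeriv (fun φ => fderiv ℝ (dualLegendre W) φ ψ) (fderiv ℝ W J) s =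
      multisetDeriv (dualLegendre W) (fderiv ℝ W J) (ψ ::ₘ s) := by
    intro s ψ
    rw [← multisetDeriv_clm_apply hΓ.fderiv, multisetDeriv_fderiv_apply hΓ]
  simp only [hpush] at hfaa
  rw [hzero, sum_finpartition_eq_top_add (Finset.insert_nonempty a Y) fun p =>
    multisetDeriv (dualLegendre W) (fderiv ℝ W J) (hessian W J k ::ₘ
      p.val.map fun A => multisetDeriv (fderiv ℝ W) J (A.val.map h))] at hfaa
  -- `D²Γ` inverts `-W''`: by symmetry the left side is the derivative of `K ↦ DΓ[φ̄[K]](α) = -α(K)`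
  -- in direction `k`.
  have htop : ∀ α : StrongDual ℝ E,
      multisetDeriv (dualLegendre W) (fderiv ℝ W J) (hessian W J k ::ₘ {α}) = -α k := by
    intro α
    rw [← Multiset.cons_zero, Multiset.cons_swap, ← hpush, Multiset.cons_zero,
      multisetDeriv_singleton (hg α)]
    have h1 : HasFDerivAt (fun K => fderiv ℝ (dualLegendre W) (fderiv ℝ W K) α)
        ((fderiv ℝ (fun φ => fderiv ℝ (dualLegendre W) φ α) (fderiv ℝ W J)).comp (hessian W J))
        J :=
      (hg α).differentiableAt.hasFDerivAt.comp J hWJ.fderiv.differentiableAt.hasFDerivAt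
    have h2 := (h1.congr_of_eventuallyEq (hcomp α).symm).unique (-α).hasFDerivAt
    exact DFunLike.congr_fun h2 k
  rw [Finset.singleton_val, Multiset.map_singleton, htop, multisetDeriv_fderiv_apply hWJ] at hfaa
  linarith

theorem IsStrictlyConvexAnalytic.multiDeriv_expansion (hW : IsStrictlyConvexAnalytic W)
    (hJ : IsCoercive (hessian W J)) (X : Finset ι) (hX : 2 ≤ X.card) (h : ι → E) (k : E) :
    multiDeriv W J (adjoin k fun i : X => h i) = ∑ P : FinerPartition X,
      multiDeriv (dualLegendre W) (fderiv ℝ W J) (adjoin (hessian W J k) fun A : P.1.parts =>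
        openDeriv W J fun i : A.1 => h i) := by
  have hWJ : AnalyticAt ℝ W J := hW.analytic J trivial
  rw [multiDeriv_adjoin hWJ, map_univ_coe, hW.multisetDeriv_expansion hJ X hX]
  refine Finset.sum_congr rfl fun P _ => ?_
  rw [multiDeriv_adjoin (hW.dualLegendre_nhds hJ).1]
  simp only [openDeriv_eq_multisetDeriv hWJ]
  rw [map_univ_coe P.1.parts fun A => multisetDeriv (fderiv ℝ W) J (A.val.map h)]

/-- Strong induction on `|X|`: a finer partition has strictly smaller parts, so every factor in the
one-step expansion is already a sum over hierarchies. -/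
theorem IsStrictlyConvexAnalytic.openDeriv_eq_sum_treeCovector (hW : IsStrictlyConvexAnalytic W)
    (hJ : IsCoercive (hessian W J)) (X : Finset ι) (hX : X.Nonempty) (h : ι → E) :
    openDeriv W J (fun i : X => h i) = ∑ H : Hierarchy X, treeCovector (hessian W J)
      (fun _ _ => multiDeriv (dualLegendre W) (fderiv ℝ W J)) h H := by
  have hWJ : AnalyticAt ℝ W J := hW.analytic J trivial
  induction hn : X.card using Nat.strong_induction_on generalizing X with
  | _ n ih =>
  rcases Nat.lt_or_ge X.card 2 with hlt | hge
  · obtain ⟨i, rfl⟩ := Finset.card_eq_one.1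
      (le_antisymm (by omega) (Finset.card_pos.2 hX))
    rw [sum_hierarchy_singleton, openDeriv_eq_multisetDeriv hWJ, Finset.singleton_val,
      Multiset.map_singleton, multisetDeriv_singleton hWJ.fderiv]
    rfl
  · ext k
    rw [openDeriv_apply, hW.multiDeriv_expansion hJ X hge, sum_hierarchy_of_two_le hge, sum_apply]
    refine Finset.sum_congr rfl fun P _ => ?_
    rw [sum_apply]
    simp only [treeCovector_node_apply]
    have hA : (fun A : P.1.parts => openDeriv W J fun i : A.1 => h i) = fun A : P.1.parts =>
        ∑ H : Hierarchy A.1, treeCovector (hessian W J)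
          (fun _ _ => multiDeriv (dualLegendre W) (fderiv ℝ W J)) h H := by
      funext A
      exact ih _ (hn ▸ P.card_lt A.2) A.1 (P.1.nonempty_of_mem_parts A.2) rfl
    rw [hA]
    -- Multilinearity turns a form evaluated at sums into a sum over choices of one sub-hierarchy
    -- per part.
    exact (freezeNone (multiDeriv (dualLegendre W) (fderiv ℝ W J))
      (hessian W J k)).map_sum fun (A : P.1.parts) (H : Hierarchy A.1) =>
        treeCovector (hessian W J) (fun _ _ => multiDeriv (dualLegendre W) (fderiv ℝ W J)) h H

end Expansion

/-! ### The expansion for a finite index set -/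

section FiniteIndex

/-- The constant is the minimum of the form on the compact unit sphere; if the sphere is empty, the
space is trivial and any positive constant serves. -/
theorem isCoercive_of_pos {V : Type*} [NormedAddCommGroup V] [NormedSpace ℝ V]
    [FiniteDimensional ℝ V] (H : V →L[ℝ] V →L[ℝ] ℝ) (hH : ∀ h, h ≠ 0 → 0 < H h h) :
    IsCoercive H := by
  rcases (Metric.sphere (0 : V) 1).eq_empty_or_nonempty with hs | hs
  · refine ⟨1, one_pos, fun h => ?_⟩
    rcases eq_or_ne h 0 with rfl | hne
    · simp
    · have : (‖h‖⁻¹ • h) ∈ Metric.sphere (0 : V) 1 := by simp [norm_smul, hne]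
      simp [hs] at this
  · have : ProperSpace V := FiniteDimensional.proper_real V
    obtain ⟨w, hw, hmin⟩ := (isCompact_sphere (0 : V) 1).exists_isMinOn hs
      (f := fun h => H h h) (by fun_prop)
    refine ⟨H w w, hH w (ne_zero_of_mem_unit_sphere ⟨w, hw⟩), fun h => ?_⟩
    rcases eq_or_ne h 0 with rfl | hne
    · simp
    · have h1 : (‖h‖⁻¹ • h) ∈ Metric.sphere (0 : V) 1 := by simp [norm_smul, hne]
      have h2 : H w w ≤ H (‖h‖⁻¹ • h) (‖h‖⁻¹ • h) := hmin h1
      have h3 : 0 < ‖h‖ := norm_pos_iff.2 hne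
      simp only [map_smul, smul_apply, smul_eq_mul] at h2
      calc H w w * ‖h‖ * ‖h‖ ≤ ‖h‖⁻¹ * (‖h‖⁻¹ * H h h) * ‖h‖ * ‖h‖ := by gcongr
        _ = H h h := by field_simp

theorem adjoin_comp {α β κ : Type*} (f : α → β) (a : α) (v : κ → α) :
    (fun o => f (adjoin a v o)) = adjoin (f a) fun i => f (v i) := by
  funext o
  cases o <;> rfl

variable {Λ : Type v} [Fintype Λ]

/-- The covector given by the pairing with a field. -/
def pairingDual : (Λ → ℝ) →L[ℝ] StrongDual ℝ (Λ → ℝ) :=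
  ∑ x, (ContinuousLinearMap.proj (R := ℝ) (φ := fun _ : Λ => ℝ) x).smulRight
    (ContinuousLinearMap.proj (R := ℝ) (φ := fun _ : Λ => ℝ) x)

theorem pairingDual_apply (φ J : Λ → ℝ) : pairingDual φ J = pairing φ J := by
  simp [pairingDual, pairing, sum_apply]

/-- Reads fields as covectors, which transfers the finite-index case to the Banach space result. -/
theorem legendre_pairing (W : (Λ → ℝ) → ℝ) :
    legendre pairing W = fun φ => dualLegendre W (pairingDual φ) := by
  funext φ
  simp only [legendre, dualLegendre, pairingDual_apply]

variable [DecidableEq Λ]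

theorem pairingDual_single (x : Λ) :
    pairingDual (Pi.single x 1) = ContinuousLinearMap.proj (R := ℝ) (φ := fun _ : Λ => ℝ) x := by
  ext J
  simp [pairingDual_apply, pairing, Pi.single_apply]

theorem dual_eq_sum (ψ : StrongDual ℝ (Λ → ℝ)) :
    ψ = ∑ x, ψ (Pi.single x 1) • ContinuousLinearMap.proj (R := ℝ) (φ := fun _ : Λ => ℝ) x := by
  ext J
  conv_lhs => rw [pi_eq_sum_univ' J]
  simp [sum_apply, mul_comm]

theorem pairingDual_meanField (W : (Λ → ℝ) → ℝ) (J : Λ → ℝ) :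
    pairingDual (meanField W J) = fderiv ℝ W J := by
  rw [dual_eq_sum (fderiv ℝ W J)]
  ext K
  simp [pairingDual_apply, pairing, meanField, sum_apply]

/-- Expansion of a multilinear form on covectors in coordinates. -/
theorem map_adjoin_eq_sum {κ : Type*} [Fintype κ] [DecidableEq κ]
    (V : ContinuousMultilinearMap ℝ (fun _ : Option κ => StrongDual ℝ (Λ → ℝ)) ℝ)
    (ψ : StrongDual ℝ (Λ → ℝ)) (α : κ → StrongDual ℝ (Λ → ℝ)) :
    V (adjoin ψ α) = ∑ p : Λ, ∑ z : κ → Λ, ψ (Pi.single p 1) *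
      V (fun o => ContinuousLinearMap.proj (R := ℝ) (φ := fun _ : Λ => ℝ) (adjoin p z o)) *
      ∏ i, α i (Pi.single (z i) 1) := by
  have h1 : V (adjoin ψ α) = ∑ p : Λ, ψ (Pi.single p 1) *
      V (adjoin (ContinuousLinearMap.proj (R := ℝ) (φ := fun _ : Λ => ℝ) p) α) := by
    have := map_sum (V.toContinuousLinearMap (adjoin 0 α) none) (fun x => ψ (Pi.single x 1) •
      ContinuousLinearMap.proj (R := ℝ) (φ := fun _ : Λ => ℝ) x) Finset.univ
    simpa only [← dual_eq_sum, map_smul, smul_eq_mul,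
      ContinuousMultilinearMap.toContinuousLinearMap_apply, update_adjoin_none] using this
  rw [h1]
  refine Finset.sum_congr rfl fun p _ => ?_
  have h2 := (freezeNone V (ContinuousLinearMap.proj (R := ℝ) (φ := fun _ : Λ => ℝ) p)).map_sum
    fun (i : κ) (x : Λ) => α i (Pi.single x 1) •
      ContinuousLinearMap.proj (R := ℝ) (φ := fun _ : Λ => ℝ) x
  simp only [← dual_eq_sum, MultilinearMap.map_smul_univ] at h2
  refine (congrArg _ h2).trans ?_
  rw [Finset.mul_sum]
  refine Finset.sum_congr rfl fun z _ => ?_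
  rw [adjoin_comp, smul_eq_mul, mul_comm (∏ i, _), ← mul_assoc]
  rfl

variable {W : (Λ → ℝ) → ℝ} {J : Λ → ℝ}

theorem partialDeriv_eq_multisetDeriv {κ : Type*} [Fintype κ] (hW : AnalyticAt ℝ W J)
    (x : κ → Λ) : partialDeriv W J x =
      multisetDeriv W J (Finset.univ.val.map fun i => Pi.single (x i) 1) :=
  multiDeriv_eq_multisetDeriv hW _

theorem partialDeriv_adjoin {κ : Type*} [Fintype κ] (y : Λ) (x : κ → Λ) :
    partialDeriv W J (adjoin y x) = openDeriv W J (fun i => Pi.single (x i) 1) (Pi.single y 1) := by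
  rw [openDeriv_apply, partialDeriv, adjoin_comp fun a : Λ => (Pi.single a 1 : Λ → ℝ)]

theorem partialDeriv_pair (hW : AnalyticAt ℝ W J) (y p : Λ) :
    partialDeriv W J ![y, p] = hessian W J (Pi.single y 1) (Pi.single p 1) := by
  rw [partialDeriv_eq_multisetDeriv hW]
  have : (Finset.univ.val.map fun i => (Pi.single (![y, p] i) 1 : Λ → ℝ)) =
      Pi.single p 1 ::ₘ {Pi.single y 1} := by
    rw [Fin.univ_val_map, List.ofFn_succ, List.ofFn_succ, List.ofFn_zero]
    exact Multiset.cons_swap (Pi.single y 1 : Λ → ℝ) (Pi.single p 1) 0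
  rw [this, ← multisetDeriv_fderiv_apply hW, multisetDeriv_singleton hW.fderiv]
  rfl

theorem analyticAt_legendre_pairing
    (hΓ : AnalyticAt ℝ (dualLegendre W) (fderiv ℝ W J)) :
    AnalyticAt ℝ (legendre pairing W) (meanField W J) := by
  rw [legendre_pairing]
  rw [← pairingDual_meanField] at hΓ
  exact hΓ.fun_comp ((pairingDual (Λ := Λ)).analyticAt _)

/-- Chain rule for the linear map `pairingDual`, which sends unit fields to coordinate projections
and the mean field to `DW[J]`. -/
theorem vertex_eq_multiDeriv {κ : Type*} [Fintype κ]
    (hΓ : AnalyticAt ℝ (dualLegendre W) (fderiv ℝ W J)) (x : κ → Λ) :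
    vertex W J x = multiDeriv (dualLegendre W) (fderiv ℝ W J)
      fun i => ContinuousLinearMap.proj (R := ℝ) (φ := fun _ : Λ => ℝ) (x i) := by
  rw [vertex, partialDeriv_eq_multisetDeriv (analyticAt_legendre_pairing hΓ), legendre_pairing,
    multiDeriv_eq_multisetDeriv hΓ]
  have hm := pairingDual_meanField W J
  refine (multisetDeriv_comp_clm (pairingDual (Λ := Λ)) (u := meanField W J)
    (hm.symm ▸ hΓ) _).trans ?_
  rw [hm, Multiset.map_map]
  simp only [Function.comp_def, pairingDual_single]

theorem IsStrictlyConvexAnalytic.partialDeriv_expansion (hW : IsStrictlyConvexAnalytic W)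
    (hJ : IsCoercive (hessian W J)) {ι : Type u} [DecidableEq ι] (X : Finset ι)
    (hX : 2 ≤ X.card) (x : ι → Λ) (y : Λ) :
    partialDeriv W J (adjoin y fun i : X => x i) =
      ∑ P : FinerPartition X, ∑ p : Λ, ∑ z : P.1.parts → Λ,
        partialDeriv W J ![y, p] * vertex W J (adjoin p z) *
          ∏ A : P.1.parts, partialDeriv W J (adjoin (z A) fun i : A.1 => x i) := by
  have hWJ : AnalyticAt ℝ W J := hW.analytic J trivial
  rw [partialDeriv_adjoin, openDeriv_apply,
    hW.multiDeriv_expansion hJ X hX fun i => (Pi.single (x i) 1 : Λ → ℝ)]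
  refine Finset.sum_congr rfl fun P _ => ?_
  rw [map_adjoin_eq_sum]
  simp only [partialDeriv_pair hWJ, vertex_eq_multiDeriv (hW.dualLegendre_nhds hJ).1,
    partialDeriv_adjoin]

/-- Summing over dummy labels is the same as inserting covectors expanded in coordinate projections,
node by node. -/
theorem treeAmplitude_eq_treeCovector (hWJ : AnalyticAt ℝ W J)
    (hΓ : AnalyticAt ℝ (dualLegendre W) (fderiv ℝ W J)) {ι : Type u} [DecidableEq ι]
    (x : ι → Λ) {X : Finset ι} (H : Hierarchy X) (y : Λ) :
    treeAmplitude (fun a b => partialDeriv W J ![a, b]) (fun _ _ => vertex W J) x H y =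
      treeCovector (hessian W J) (fun _ _ => multiDeriv (dualLegendre W) (fderiv ℝ W J))
        (fun i => Pi.single (x i) 1) H (Pi.single y 1) := by
  induction H generalizing y with
  -- The two leaf conventions put the external label and the source label in opposite slots of
  -- `W''`.
  | leaf i => rw [treeAmplitude, treeCovector, partialDeriv_pair hWJ, hessian_symm hWJ]
  | node P sub ih =>
    rw [treeAmplitude, treeCovector_node_apply, map_adjoin_eq_sum]
    simp only [partialDeriv_pair hWJ] at ih
    simp only [partialDeriv_pair hWJ, vertex_eq_multiDeriv hΓ] at ih ⊢
    simp only [ih]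

theorem IsStrictlyConvexAnalytic.partialDeriv_eq_sum_treeAmplitude
    (hW : IsStrictlyConvexAnalytic W) (hJ : IsCoercive (hessian W J)) {ι : Type u} [DecidableEq ι]
    (X : Finset ι) (hX : X.Nonempty) (x : ι → Λ) (y : Λ) :
    partialDeriv W J (adjoin y fun i : X => x i) = ∑ H : Hierarchy X,
      treeAmplitude (fun a b => partialDeriv W J ![a, b]) (fun _ _ => vertex W J) x H y := by
  have hWJ : AnalyticAt ℝ W J := hW.analytic J trivial
  rw [partialDeriv_adjoin,
    hW.openDeriv_eq_sum_treeCovector hJ X hX fun i => (Pi.single (x i) 1 : Λ → ℝ), sum_apply]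
  simp only [treeAmplitude_eq_treeCovector hWJ (hW.dualLegendre_nhds hJ).1]

end FiniteIndex

/-! ### Cumulants as derivatives of the logarithm of the Laplace transform -/

section Cumulants

theorem continuous_monomial {Λ : Type v} (s : Multiset Λ) : Continuous fun φ : Λ → ℝ => (s.map φ).prod := by
  induction s using Multiset.induction_on with
  | empty => simpa using continuous_const
  | cons x s ih => simpa using (continuous_apply x).fun_mul ih

variable {Λ : Type v} [Fintype Λ]


theorem pairing_add (φ J K : Λ → ℝ) : pairing φ (J + K) = pairing φ J + pairing φ K := by
  simp [pairing, mul_add, Finset.sum_add_distrib]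

theorem continuous_pairing_left (J : Λ → ℝ) : Continuous fun φ : Λ → ℝ => pairing φ J := by
  unfold pairing
  fun_prop

/-- Supplies a bound uniform in `t` for differentiation under the integral: small shifts of the
source are dominated by the two unit shifts. -/
theorem exp_mul_le_exp_add_exp_neg {t : ℝ} (ht : |t| ≤ 1) (a : ℝ) :
    Real.exp (t * a) ≤ Real.exp a + Real.exp (-a) := by
  have h : t * a ≤ |a| := by
    calc t * a ≤ |t * a| := le_abs_self _
      _ = |t| * |a| := abs_mul _ _
      _ ≤ 1 * |a| := by gcongr
      _ = |a| := one_mul _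
  refine (Real.exp_le_exp.2 h).trans ?_
  rcases abs_choice a with h | h <;> rw [h]
  · linarith [Real.exp_pos (-a)]
  · linarith [Real.exp_pos a]

theorem abs_le_exp_add_exp_neg (a : ℝ) : |a| ≤ Real.exp a + Real.exp (-a) := by
  rcases abs_choice a with h | h <;> rw [h]
  · linarith [Real.add_one_le_exp a, Real.exp_pos (-a)]
  · linarith [Real.add_one_le_exp (-a), Real.exp_pos a]

variable {ν : Measure (Λ → ℝ)}

/-- The unnormalized moments of the state with source `J`. -/
def laplaceMoment (ν : Measure (Λ → ℝ)) (s : Multiset Λ) (J : Λ → ℝ) : ℝ :=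
  ∫ φ, (s.map φ).prod * Real.exp (pairing φ J) ∂ν

theorem exp_logLaplace [IsProbabilityMeasure ν]
    (hν : ∀ J, Integrable (fun φ => Real.exp (pairing φ J)) ν) (J : Λ → ℝ) :
    Real.exp (logLaplace ν J) = laplaceMoment ν 0 J := by
  rw [logLaplace, Real.exp_log (integral_exp_pos (hν J)), laplaceMoment]
  simp

theorem integral_sourced [IsProbabilityMeasure ν]
    (hν : ∀ J, Integrable (fun φ => Real.exp (pairing φ J)) ν)
    (s : Multiset Λ) (J : Λ → ℝ) :
    ∫ φ, (s.map φ).prod ∂(sourced ν J) =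
      (Real.exp (logLaplace ν J))⁻¹ * laplaceMoment ν s J := by
  rw [sourced, integral_tilted, logLaplace, Real.exp_log (integral_exp_pos (hν J)),
    laplaceMoment, ← integral_const_mul]
  refine integral_congr_ae (Eventually.of_forall fun φ => ?_)
  simp only [smul_eq_mul]
  ring

variable [DecidableEq Λ]

theorem pairing_smul_single (φ : Λ → ℝ) (t : ℝ) (x : Λ) :
    pairing φ (t • Pi.single x 1) = t * φ x := by
  simp [pairing, Pi.single_apply, mul_comm]

theorem pairing_single (φ : Λ → ℝ) (x : Λ) : pairing φ (Pi.single x 1) = φ x := by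
  simp [pairing, Pi.single_apply]

theorem pairing_neg_single (φ : Λ → ℝ) (x : Λ) : pairing φ (-Pi.single x 1) = -φ x := by
  simp [pairing, Pi.single_apply]

/-- Each factor `φ x` is absorbed by `e^{φ x} + e^{-φ x}`, that is, by shifting the source by `±
Pi.single x 1`; hence the induction ranges over all `J`. -/
theorem integrable_monomial_mul_exp
    (hν : ∀ J, Integrable (fun φ => Real.exp (pairing φ J)) ν) (s : Multiset Λ) (J : Λ → ℝ) :
    Integrable (fun φ => (s.map φ).prod * Real.exp (pairing φ J)) ν := by
  induction s using Multiset.induction_on generalizing J with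
  | empty => simpa using hν J
  | cons x s ih =>
    refine Integrable.mono' ((ih (J + Pi.single x 1)).norm.add (ih (J + -Pi.single x 1)).norm)
      ((continuous_monomial _).mul
        (Real.continuous_exp.comp (continuous_pairing_left J))).aestronglyMeasurable
      (Eventually.of_forall fun φ => ?_)
    simp only [Multiset.map_cons, Multiset.prod_cons, norm_mul, Real.norm_eq_abs, Real.abs_exp,
      Pi.add_apply, pairing_add, pairing_single, pairing_neg_single, Real.exp_add]
    have h1 := abs_le_exp_add_exp_neg (φ x)
    have h2 : 0 ≤ |(s.map φ).prod| * Real.exp (pairing φ J) := by positivity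
    nlinarith [mul_le_mul_of_nonneg_left h1 h2]

theorem hasLineDerivAt_laplaceMoment
    (hν : ∀ J, Integrable (fun φ => Real.exp (pairing φ J)) ν) (s : Multiset Λ) (J : Λ → ℝ)
    (x : Λ) :
    HasLineDerivAt ℝ (laplaceMoment ν s) (laplaceMoment ν (x ::ₘ s) J) J (Pi.single x 1) := by
  have hmeas : ∀ (s : Multiset Λ) (K : Λ → ℝ),
      AEStronglyMeasurable (fun φ => (s.map φ).prod * Real.exp (pairing φ K)) ν := fun s K =>
    (integrable_monomial_mul_exp hν s K).aestronglyMeasurable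
  have hbound : ∀ φ : Λ → ℝ, ∀ t ∈ Metric.ball (0 : ℝ) 1,
      ‖((x ::ₘ s).map φ).prod * Real.exp (pairing φ (J + t • Pi.single x 1))‖ ≤
        ‖((x ::ₘ s).map φ).prod * Real.exp (pairing φ (J + Pi.single x 1))‖ +
        ‖((x ::ₘ s).map φ).prod * Real.exp (pairing φ (J + -Pi.single x 1))‖ := by
    intro φ t ht
    have ht' : |t| ≤ 1 := by simpa using (mem_ball_zero_iff.1 ht).le
    simp only [norm_mul, Real.norm_eq_abs, Real.abs_exp, pairing_add, pairing_smul_single,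
      pairing_single, pairing_neg_single, Real.exp_add]
    have h1 := exp_mul_le_exp_add_exp_neg ht' (φ x)
    have h2 : 0 ≤ |((x ::ₘ s).map φ).prod| * Real.exp (pairing φ J) := by positivity
    nlinarith [mul_le_mul_of_nonneg_left h1 h2]
  have hderiv : ∀ φ : Λ → ℝ, ∀ t ∈ Metric.ball (0 : ℝ) 1,
      HasDerivAt (fun t : ℝ => (s.map φ).prod * Real.exp (pairing φ (J + t • Pi.single x 1)))
        (((x ::ₘ s).map φ).prod * Real.exp (pairing φ (J + t • Pi.single x 1))) t := by
    intro φ t _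
    have h1 : HasDerivAt (fun t : ℝ => pairing φ (J + t • Pi.single x 1)) (φ x) t := by
      simp only [pairing_add, pairing_smul_single]
      simpa using ((hasDerivAt_id t).mul_const (φ x)).const_add (pairing φ J)
    refine (h1.exp.const_mul (s.map φ).prod).congr_deriv ?_
    rw [Multiset.map_cons, Multiset.prod_cons]
    ring
  have h := (hasDerivAt_integral_of_dominated_loc_of_deriv_le (μ := ν)
    (Metric.ball_mem_nhds (0 : ℝ) one_pos)
    (Eventually.of_forall fun t : ℝ => hmeas s (J + t • Pi.single x 1))
    (integrable_monomial_mul_exp hν s (J + (0 : ℝ) • Pi.single x 1))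
    (hmeas (x ::ₘ s) (J + (0 : ℝ) • Pi.single x 1)) (Eventually.of_forall hbound)
    ((integrable_monomial_mul_exp hν (x ::ₘ s) (J + Pi.single x 1)).norm.add
      (integrable_monomial_mul_exp hν (x ::ₘ s) (J + -Pi.single x 1)).norm)
    (Eventually.of_forall hderiv)).2
  rw [zero_smul, add_zero] at h
  exact h

variable [IsProbabilityMeasure ν]

/-- Analyticity of `ln Z` already makes the moments differentiable, so the derivative under the
integral is needed only along coordinate lines to identify its value. -/
theorem multisetDeriv_laplaceMoment (hν : ∀ J, Integrable (fun φ => Real.exp (pairing φ J)) ν)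
    (hW : AnalyticOnNhd ℝ (logLaplace ν) Set.univ) (s : Multiset Λ) (J : Λ → ℝ) :
    multisetDeriv (fun K => Real.exp (logLaplace ν K)) J (s.map fun x => Pi.single x 1) =
      laplaceMoment ν s J := by
  have hZ : ∀ J, AnalyticAt ℝ (fun K => Real.exp (logLaplace ν K)) J := fun J =>
    (hW J trivial).rexp'
  induction s using Multiset.induction_on generalizing J with
  | empty => rw [Multiset.map_zero, multisetDeriv_zero, exp_logLaplace hν]
  | cons x s ih =>
    have hM : laplaceMoment ν s = fun J =>
        multisetDeriv (fun K => Real.exp (logLaplace ν K)) J (s.map fun x => Pi.single x 1) := by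
      funext J
      exact (ih J).symm
    have hd : DifferentiableAt ℝ (laplaceMoment ν s) J := by
      rw [hM]
      exact (analyticAt_multisetDeriv (hZ J) _).differentiableAt
    rw [Multiset.map_cons, multisetDeriv_cons (hZ J), ← hM]
    exact HasDerivAt.unique (hd.hasFDerivAt.hasLineDerivAt _)
      (hasLineDerivAt_laplaceMoment hν s J x)

theorem integral_sourced_eq_meanField
    (hν : ∀ J, Integrable (fun φ => Real.exp (pairing φ J)) ν)
    (hW : AnalyticOnNhd ℝ (logLaplace ν) Set.univ) (J : Λ → ℝ) (x : Λ) :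
    ∫ φ, φ x ∂(sourced ν J) = meanField (logLaplace ν) J x := by
  have h := integral_sourced hν {x} J
  rw [← multisetDeriv_laplaceMoment hν hW, Multiset.map_singleton,
    multisetDeriv_singleton (hW J trivial).rexp',
    ((hW J trivial).differentiableAt.hasFDerivAt.exp).fderiv, smul_apply, smul_eq_mul,
    inv_mul_cancel_left₀ (Real.exp_ne_zero _)] at h
  simpa [meanField] using h

/-- Moments as sums over partitions of products of derivatives of `ln Z`. -/
theorem integral_sourced_eq_sum (hν : ∀ J, Integrable (fun φ => Real.exp (pairing φ J)) ν)
    (hW : AnalyticOnNhd ℝ (logLaplace ν) Set.univ) (J : Λ → ℝ) {κ : Type*} [DecidableEq κ]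
    (x : κ → Λ) (S : Finset κ) :
    ∫ φ, ∏ i ∈ S, φ (x i) ∂(sourced ν J) = ∑ P : Finpartition S, ∏ A ∈ P.parts,
      multisetDeriv (logLaplace ν) J (A.val.map fun i => Pi.single (x i) 1) := by
  have h := integral_sourced hν (S.val.map x) J
  simp only [Multiset.map_map] at h
  refine Eq.trans h ?_
  rw [← multisetDeriv_laplaceMoment hν hW, Multiset.map_map]
  -- Every derivative of `exp` is `exp` times the product of the directions; the common factor `e^W`
  -- cancels the normalization.
  have hF := multisetDeriv_comp (hW J trivial) (analyticAt_rexp (x := logLaplace ν J)) S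
    fun i => (Pi.single (x i) 1 : Λ → ℝ)
  simp only [multisetDeriv_exp, ← Finset.mul_sum] at hF
  refine (congrArg _ hF).trans ?_
  rw [inv_mul_cancel_left₀ (Real.exp_ne_zero _)]
  rfl

/-- The coarsest partition contributes `c S`, all others only values on smaller sets, so the moment
relation determines `c` recursively. Parts are non-empty, so `c ∅` never enters and stays
undetermined. -/
theorem ursell_eq_of_moments {κ : Type u} [DecidableEq κ] (m c : Finset κ → ℝ)
    (h : ∀ S, m S = ∑ P : Finpartition S, ∏ A ∈ P.parts, c A) (S : Finset κ) (hS : S.Nonempty) :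
    ursell m S = c S := by
  induction hn : S.card using Nat.strong_induction_on generalizing S with
  | _ n ih =>
  rw [ursell, h, sum_finpartition_eq_top_add hS fun p => ∏ A ∈ p, c A, Finset.prod_singleton]
  have : ∑ P : FinerPartition S, ∏ A : P.1.parts, ursell m A.1 =
      ∑ P : FinerPartition S, ∏ A ∈ P.1.parts, c A := by
    refine Finset.sum_congr rfl fun P _ => ?_
    refine Eq.trans ?_ (Finset.prod_coe_sort P.1.parts c)
    exact Finset.prod_congr rfl fun (A : P.1.parts) _ =>
      ih _ (hn ▸ P.card_lt A.2) A.1 (P.1.nonempty_of_mem_parts A.2) rfl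
  rw [this, add_sub_cancel_right]

theorem cumulant_sourced (hν : ∀ J, Integrable (fun φ => Real.exp (pairing φ J)) ν)
    (hW : AnalyticOnNhd ℝ (logLaplace ν) Set.univ) (J : Λ → ℝ) {κ : Type u} [Fintype κ]
    [Nonempty κ] (x : κ → Λ) :
    cumulant (sourced ν J) x = partialDeriv (logLaplace ν) J x := by
  classical
  rw [cumulant, ursell_eq_of_moments _ _ (integral_sourced_eq_sum hν hW J x) _
    Finset.univ_nonempty, partialDeriv_eq_multisetDeriv (hW J trivial)]

end Cumulants

end

end FieldCalculus

theorem mainTheorem2 :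
    -- sources and fields over a finite index set
    (∀ (Λ : Type v) [Fintype Λ] [DecidableEq Λ] (W : (Λ → ℝ) → ℝ),
      FieldCalculus.IsStrictlyConvexAnalytic W →
      ∀ J : Λ → ℝ, (∀ h : Λ → ℝ, h ≠ 0 → 0 < FieldCalculus.hessian W J h h) →
        (∀ K : Λ → ℝ, K ≠ J →
          W J - FieldCalculus.pairing (FieldCalculus.meanField W J) J <
            W K - FieldCalculus.pairing (FieldCalculus.meanField W J) K) ∧
        AnalyticAt ℝ (FieldCalculus.legendre FieldCalculus.pairing W)
          (FieldCalculus.meanField W J) ∧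
        ∀ (ι : Type u) [DecidableEq ι] (X : Finset ι) (x : ι → Λ) (y : Λ),
          (2 ≤ X.card →
            FieldCalculus.partialDeriv W J (FieldCalculus.adjoin y fun i : X => x i) =
              ∑ P : FieldCalculus.FinerPartition X, ∑ p : Λ, ∑ z : P.1.parts → Λ,
                FieldCalculus.partialDeriv W J ![y, p] *
                FieldCalculus.vertex W J (FieldCalculus.adjoin p z) *
                ∏ A : P.1.parts,
                  FieldCalculus.partialDeriv W J
                    (FieldCalculus.adjoin (z A) fun i : A.1 => x i)) ∧
          (X.Nonempty →
            FieldCalculus.partialDeriv W J (FieldCalculus.adjoin y fun i : X => x i) =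
              ∑ H : FieldCalculus.Hierarchy X,
                FieldCalculus.treeAmplitude (fun a b => FieldCalculus.partialDeriv W J ![a, b])
                  (fun _ _ => FieldCalculus.vertex W J) x H y)) ∧
    -- connected cumulants in the presence of a source
    (∀ (Λ : Type v) [Fintype Λ] [DecidableEq Λ] (ν : Measure (Λ → ℝ)) [IsProbabilityMeasure ν],
      (∀ J : Λ → ℝ, Integrable (fun φ => Real.exp (FieldCalculus.pairing φ J)) ν) →
      FieldCalculus.IsStrictlyConvexAnalytic (FieldCalculus.logLaplace ν) →
      ∀ J : Λ → ℝ,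
        (∀ h : Λ → ℝ, h ≠ 0 → 0 < FieldCalculus.hessian (FieldCalculus.logLaplace ν) J h h) →
        (∀ x : Λ, ∫ φ, φ x ∂(FieldCalculus.sourced ν J) =
          FieldCalculus.meanField (FieldCalculus.logLaplace ν) J x) ∧
        ∀ (ι : Type u) [DecidableEq ι] (X : Finset ι) (x : ι → Λ) (y : Λ),
          (2 ≤ X.card →
            FieldCalculus.cumulant (FieldCalculus.sourced ν J)
                (FieldCalculus.adjoin y fun i : X => x i) =
              ∑ P : FieldCalculus.FinerPartition X, ∑ p : Λ, ∑ z : P.1.parts → Λ,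
                FieldCalculus.cumulant (FieldCalculus.sourced ν J) ![y, p] *
                FieldCalculus.vertex (FieldCalculus.logLaplace ν) J (FieldCalculus.adjoin p z) *
                ∏ A : P.1.parts,
                  FieldCalculus.cumulant (FieldCalculus.sourced ν J)
                    (FieldCalculus.adjoin (z A) fun i : A.1 => x i)) ∧
          (X.Nonempty →
            FieldCalculus.cumulant (FieldCalculus.sourced ν J)
                (FieldCalculus.adjoin y fun i : X => x i) =
              ∑ H : FieldCalculus.Hierarchy X,
                FieldCalculus.treeAmplitude
                  (fun a b => FieldCalculus.cumulant (FieldCalculus.sourced ν J) ![a, b])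
                  (fun _ _ => FieldCalculus.vertex (FieldCalculus.logLaplace ν) J) x H y)) ∧
    -- index-free form for a Banach space of sources
    (∀ (E : Type v) [NormedAddCommGroup E] [NormedSpace ℝ E] [CompleteSpace E] (W : E → ℝ),
      FieldCalculus.IsStrictlyConvexAnalytic W →
      ∀ J : E, IsCoercive (FieldCalculus.hessian W J) →
        (∀ K : E, K ≠ J → W J - fderiv ℝ W J J < W K - fderiv ℝ W J K) ∧
        AnalyticAt ℝ (FieldCalculus.dualLegendre W) (fderiv ℝ W J) ∧
        ∀ (ι : Type u) [DecidableEq ι] (X : Finset ι) (h : ι → E) (k : E),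
          (2 ≤ X.card →
            FieldCalculus.multiDeriv W J (FieldCalculus.adjoin k fun i : X => h i) =
              ∑ P : FieldCalculus.FinerPartition X,
                FieldCalculus.multiDeriv (FieldCalculus.dualLegendre W) (fderiv ℝ W J)
                  (FieldCalculus.adjoin (FieldCalculus.hessian W J k) fun A : P.1.parts =>
                    FieldCalculus.openDeriv W J fun i : A.1 => h i)) ∧
          (X.Nonempty →
            FieldCalculus.multiDeriv W J (FieldCalculus.adjoin k fun i : X => h i) =
              ∑ H : FieldCalculus.Hierarchy X,
                FieldCalculus.treeCovector (FieldCalculus.hessian W J)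
                  (fun _ _ => FieldCalculus.multiDeriv (FieldCalculus.dualLegendre W)
                    (fderiv ℝ W J)) h H k)) := by
  refine ⟨?_, ?_, ?_⟩
  · intro Λ _ _ W hW J hJ
    have hc := FieldCalculus.isCoercive_of_pos _ hJ
    refine ⟨fun K hK => ?_,
      FieldCalculus.analyticAt_legendre_pairing (hW.dualLegendre_nhds hc).1,
      fun ι _ X x y => ⟨fun hX => hW.partialDeriv_expansion hc X hX x y,
        fun hX => hW.partialDeriv_eq_sum_treeAmplitude hc X hX x y⟩⟩
    simp only [← FieldCalculus.pairingDual_apply, FieldCalculus.pairingDual_meanField]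
    exact hW.sub_fderiv_lt hK
  · intro Λ _ _ ν _ hν hW J hJ
    have hc := FieldCalculus.isCoercive_of_pos _ hJ
    refine ⟨FieldCalculus.integral_sourced_eq_meanField hν hW.analytic J,
      fun ι _ X x y => ⟨fun hX => ?_, fun hX => ?_⟩⟩
    · simp only [FieldCalculus.cumulant_sourced hν hW.analytic]
      exact hW.partialDeriv_expansion hc X hX x y
    · simp only [FieldCalculus.cumulant_sourced hν hW.analytic]
      exact hW.partialDeriv_eq_sum_treeAmplitude hc X hX x y
  · intro E _ _ _ W hW J hJ
    refine ⟨fun K hK => hW.sub_fderiv_lt hK, (hW.dualLegendre_nhds hJ).1,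
      fun ι _ X h k => ⟨fun hX => hW.multiDeriv_expansion hJ X hX h k, fun hX => ?_⟩⟩
    rw [← FieldCalculus.openDeriv_apply, hW.openDeriv_eq_sum_treeCovector hJ X hX, sum_apply]
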